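/- Let $\Sigma$ be a finite alphabet. A (nondeterministic) one-counter automaton over $\Sigma$ consists of a finite set $Q$ of states, a set $T_{>0}\subseteq Q\times\{-1,0,1\}\times Q$ of non-zero transitions, a set $T_{=0}\subseteq Q\times\{0,1\}\times Q$ of zero tests, a label $\lambda(t)\in\Sigma\cup\{\varepsilon\}$ for every $t\in T_{>0}\cup T_{=0}$, and sets $I,F\subseteq Q$ of initial and final states. Its configurations are the pairs $(q,c)\in Q\times\mathbb{N}$, where $\mathbb{N}=\{0,1,2,\dots\}$. A transition $(p,d,q)$ leads from $(p,c)$ to $(q,c+d)$ whenever either $c\ge 1$ and $(p,d,q)\in T_{>0}$, or $c=0$ and $(p,d,q)\in T_{=0}$. The automaton accepts a word $w\in\Sigma^*$ if $w$ is the concatenation of the labels along a path (possibly of length $0$) from a configuration in $I\times\{0\}$ to a configuration in $F\times\mathbb{N}$; its language is the set of all accepted words. (1) If a one-counter automaton with $n$ states has a non-empty language, then it accepts some word of length at most $14n^2$. (2) This quadratic bound is optimal up to a constant factor: there are a constant $c>0$ and an integer $N$ such that, for every $n\ge N$ and every non-empty finite alphabet $\Sigma$, there is a one-counter automaton over $\Sigma$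 with $n$ states whose language is non-empty and all of whose accepted words have length at least $cn^2$. -/

import Mathlib

universe u v

/-- A one-counter system with state set `Q`: a set of non-zero transitions
`T_{>0} ⊆ Q × {-1,0,1} × Q` and a set of zero tests `T_{=0} ⊆ Q × {0,1} × Q`. -/
structure OneCounterSystem (Q : Type*) where
  /-- the non-zero transitions, fired at positive counter values -/
  nonzeroTransitions : Set (Q × ℤ × Q)
  /-- the zero tests, fired at counter value zero -/
  zeroTests : Set (Q × ℤ × Q)
  nonzero_effect : ∀ t ∈ nonzeroTransitions, t.2.1 ∈ ({-1, 0, 1} : Set ℤ)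
  zero_effect : ∀ t ∈ zeroTests, t.2.1 ∈ ({0, 1} : Set ℤ)

namespace OneCounterSystem

/-- `S.Fires t γ γ'`: the transition `t = (p, d, q)` can be fired in the configuration
`γ = (p, c)`, and the result is the configuration `γ' = (q, c + d)`. -/
def Fires {Q : Type*} (S : OneCounterSystem Q) (t : Q × ℤ × Q) (γ γ' : Q × ℕ) : Prop :=
  ((1 ≤ γ.2 ∧ t ∈ S.nonzeroTransitions) ∨ (γ.2 = 0 ∧ t ∈ S.zeroTests)) ∧
    γ.1 = t.1 ∧ γ'.1 = t.2.2 ∧ (γ'.2 : ℤ) = (γ.2 : ℤ) + t.2.1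

/-- `S.IsPath γ σ γ'`: firing the transitions of the sequence `σ` one after the other is a path
of `S` from the configuration `γ` to the configuration `γ'`. -/
inductive IsPath {Q : Type*} (S : OneCounterSystem Q) :
    Q × ℕ → List (Q × ℤ × Q) → Q × ℕ → Prop
  | nil (γ : Q × ℕ) : IsPath S γ [] γ
  | cons {γ γ' γ'' : Q × ℕ} {t : Q × ℤ × Q} {σ : List (Q × ℤ × Q)} :
      S.Fires t γ γ' → IsPath S γ' σ γ'' → IsPath S γ (t :: σ) γ''

end OneCounterSystem

/-- A (nondeterministic) one-counter automaton over the input alphabet `A` with state set `Q`: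
a one-counter system whose transitions carry labels in `A ∪ {ε}` (`none` stands for `ε`),
with sets of initial and final states. The values of `label` at triples
that are not transitions are irrelevant. -/
structure OneCounterAutomaton (A Q : Type*) extends OneCounterSystem Q where
  /-- the label of a transition -/
  label : Q × ℤ × Q → Option A
  /-- the initial states -/
  initial : Set Q
  /-- the final states -/
  final : Set Q

namespace OneCounterAutomaton

/-- The label of a sequence of transitions: the concatenation of the labels, `ε` being the
empty word. -/
def word {A Q : Type*} (M : OneCounterAutomaton A Q) (σ : List (Q × ℤ × Q)) : List A :=
  σ.filterMap M.label

/-- The language of the automaton: all labels of paths from `I × {0}` to `F × ℕ`. -/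
def language {A Q : Type*} (M : OneCounterAutomaton A Q) : Language A :=
  {w | ∃ p ∈ M.initial, ∃ q ∈ M.final, ∃ (c : ℕ) (σ : List (Q × ℤ × Q)),
    M.toOneCounterSystem.IsPath (p, 0) σ (q, c) ∧ M.word σ = w}

end OneCounterAutomaton

/-! Upper bound. Let n be the number of states. Counter values below 2n are kept exactly. If a run
rises from n to 2n, a state recurs at a larger value, so the run meets a simple cycle of positive
effect; on the way down it likewise meets one of negative effect. Fix maximal families `A`, `B` of
rising and falling cycles ("loops") with pairwise disjoint supports. By maximality every rise meets
some X of `A` and every descent some Y of `B`. By disjointness the cycle lengths in each family add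
up to at most n.

Compress the configuration graph. A vertex is either a low configuration or a state inside a high
excursion tagged with X and Y. Entering constrains the value η only modulo `eff X`, leaving only
modulo `eff Y`, and positivity inside is ignored. Every accepting run gives a compressed path
(`exists_reflTransGen_low`). Conversely an excursion is realized by enough turns of X, then the
walk, then turns of Y back down (`exists_stepsIn_excursion`); the Chinese remainder theorem supplies
the numbers of turns.

On a shortest compressed path, two excursions can be merged, entering by the first and leaving by
the second, once their values agree modulo the gcd of the two effects involved. The lemmas
`not_dvd_of_high`, `not_dvd_of_entry` and `not_dvd_of_exit` therefore bound how often each kind of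
edge occurs. The cost of a step contains |X| / `eff X`, but at most n · `eff X` such steps use X.
The cost of an entry contains an lcm term with denominator gcd(`eff X`, `eff Y`), but at most that
gcd many entries use the pair. So every denominator cancels, and `sum_edgeCost_le` totals 14n².

Lower bound. With cycles of coprime lengths k and k + 1, one incrementing and one decrementing, the
zero test is passed only from a positive common multiple, hence one of size at least k(k + 1). -/

/-! ### Counted steps and shortest paths. -/

/-- `StepsIn r k a b`: there is a path with `k` steps of the relation `r` from `a` to `b`. -/
inductive StepsIn {α : Type*} (r : α → α → Prop) : ℕ → α → α → Prop
  | refl (a : α) : StepsIn r 0 a a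
  | head {a b c : α} {k : ℕ} : r a b → StepsIn r k b c → StepsIn r (k + 1) a c

namespace StepsIn

variable {α : Type*} {r : α → α → Prop} {a b c : α} {k l : ℕ}

theorem single (h : r a b) : StepsIn r 1 a b := head h (refl b)

theorem trans (h : StepsIn r k a b) (h' : StepsIn r l b c) : StepsIn r (k + l) a c := by
  induction h with
  | refl a => simpa using h'
  | head hr _ ih => rw [Nat.add_right_comm]; exact head hr (ih h')

theorem cast (h : StepsIn r k a b) (e : k = l) : StepsIn r l a b := e ▸ h

theorem exists_fun (h : StepsIn r k a b) :
    ∃ f : ℕ → α, f 0 = a ∧ f k = b ∧ ∀ i < k, r (f i) (f (i + 1)) := by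
  induction h with
  | refl a => exact ⟨fun _ => a, rfl, rfl, by simp⟩
  | @head a b c k hr _ ih =>
    obtain ⟨f, h0, hk, hf⟩ := ih
    refine ⟨fun i => Nat.casesOn i a f, rfl, hk, fun i hi => ?_⟩
    cases i with
    | zero => simpa [h0] using hr
    | succ i => exact hf i (by omega)

theorem of_fun {f : ℕ → α} (hf : ∀ i < k, r (f i) (f (i + 1))) {i j : ℕ} (hij : i ≤ j)
    (hj : j ≤ k) : StepsIn r (j - i) (f i) (f j) := by
  induction j, hij using Nat.le_induction with
  | base => simpa using refl (r := r) (f i)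
  | succ j hij ih =>
    exact ((ih (by omega)).trans (single (hf j (by omega)))).cast (by omega)

theorem of_reflTransGen (h : Relation.ReflTransGen r a b) : ∃ k, StepsIn r k a b := by
  induction h with
  | refl => exact ⟨0, refl a⟩
  | tail _ hr ih => obtain ⟨k, hk⟩ := ih; exact ⟨k + 1, hk.trans (single hr)⟩

theorem exists_shortest (h : StepsIn r k a b) :
    ∃ (m : ℕ) (f : ℕ → α), m ≤ k ∧ f 0 = a ∧ f m = b ∧ (∀ i < m, r (f i) (f (i + 1))) ∧
      ∀ i j l, i ≤ j → j ≤ m → StepsIn r l (f i) (f j) → j - i ≤ l := by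
  classical
  have hex : ∃ k, StepsIn r k a b := ⟨k, h⟩
  obtain ⟨f, h0, hm, hf⟩ := (Nat.find_spec hex).exists_fun
  refine ⟨Nat.find hex, f, Nat.find_min' hex h, h0, hm, hf, fun i j l hij hj hl => ?_⟩
  have h1 := of_fun hf (Nat.zero_le i) (hij.trans hj)
  have h2 := of_fun hf hj le_rfl
  rw [h0] at h1
  rw [hm] at h2
  have := Nat.find_min' hex ((h1.trans hl).trans h2)
  omega

theorem exists_lt_card [Fintype α] (h : StepsIn r k a b) :
    ∃ m < Fintype.card α, StepsIn r m a b := by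
  obtain ⟨m, f, -, h0, hm, hf, hmin⟩ := h.exists_shortest
  refine ⟨m, ?_, by simpa [h0, hm] using of_fun hf (Nat.zero_le m) le_rfl⟩
  have hinj : Function.Injective (fun i : Fin (m + 1) => f i) := by
    intro i j hij
    have key : ∀ i j : ℕ, i ≤ j → j ≤ m → f i = f j → j ≤ i := fun i j h1 h2 h3 => by
      have := hmin i j 0 h1 h2 (h3 ▸ refl _)
      omega
    have hi := i.2
    have hj := j.2
    ext
    rcases le_total (i : ℕ) j with h1 | h1
    · exact le_antisymm h1 (key i j h1 (by omega) hij)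
    · exact le_antisymm (key j i h1 (by omega) hij.symm) h1
  have := Fintype.card_le_of_injective _ hinj
  simp at this
  omega

end StepsIn

theorem Nat.exists_first {P : ℕ → Prop} {a b : ℕ} (hab : a ≤ b) (hb : P b) :
    ∃ m, a ≤ m ∧ m ≤ b ∧ P m ∧ ∀ i, a ≤ i → i < m → ¬ P i := by
  classical
  have hex : ∃ m, a ≤ m ∧ P m := ⟨b, hab, hb⟩
  exact ⟨Nat.find hex, (Nat.find_spec hex).1, Nat.find_min' hex ⟨hab, hb⟩, (Nat.find_spec hex).2,
    fun i hi hlt hP => Nat.find_min hex hlt ⟨hi, hP⟩⟩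

theorem Nat.exists_last {P : ℕ → Prop} {a b : ℕ} (hab : a ≤ b) (ha : P a) :
    ∃ m, a ≤ m ∧ m ≤ b ∧ P m ∧ ∀ i, m < i → i ≤ b → ¬ P i := by
  classical
  exact ⟨Nat.findGreatest P b, Nat.le_findGreatest hab ha, Nat.findGreatest_le b,
    Nat.findGreatest_spec hab ha, fun i hi hb => Nat.findGreatest_is_greatest hi hb⟩

/-! ### Walks without positivity constraints, rising loops, maximal disjoint families. -/

section Walks

variable {Q : Type v}

/-- `Walk T p m d q`: there is a walk along `m` transitions of `T` from `p` to `q` with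
total effect `d`. -/
inductive Walk (T : Set (Q × ℤ × Q)) : Q → ℕ → ℤ → Q → Prop
  | nil (p : Q) : Walk T p 0 0 p
  | cons {p q r : Q} {d e : ℤ} {m : ℕ} :
      (p, d, q) ∈ T → Walk T q m e r → Walk T p (m + 1) (d + e) r

/-- The transitions with negated effects. -/
def negEffects (T : Set (Q × ℤ × Q)) : Set (Q × ℤ × Q) := {t | (t.1, -t.2.1, t.2.2) ∈ T}

/-- All effects have absolute value at most one. -/
def SmallEffects (T : Set (Q × ℤ × Q)) : Prop := ∀ p d q, (p, d, q) ∈ T → |d| ≤ 1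

variable {T : Set (Q × ℤ × Q)}

theorem SmallEffects.neg (hT : SmallEffects T) : SmallEffects (negEffects T) :=
  fun p d q h => by simpa using hT p (-d) q h

namespace Walk

theorem cast {p q : Q} {m l : ℕ} {d e : ℤ} (h : Walk T p m d q) (h1 : m = l) (h2 : d = e) :
    Walk T p l e q := h1 ▸ h2 ▸ h

theorem trans {p q r : Q} {m l : ℕ} {d e : ℤ} (h : Walk T p m d q) (h' : Walk T q l e r) :
    Walk T p (m + l) (d + e) r := by
  induction h with
  | nil p => simpa using h'
  | cons ht _ ih => exact (cons ht (ih h')).cast (by omega) (by ring)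

theorem abs_le (hT : SmallEffects T) {p q : Q} {m : ℕ} {d : ℤ} (h : Walk T p m d q) :
    |d| ≤ m := by
  induction h with
  | nil p => simp
  | @cons p q r d e m ht _ ih =>
    push_cast
    linarith [abs_add_le d e, hT _ _ _ ht]

theorem of_neg {p q : Q} {m : ℕ} {d : ℤ} (h : Walk (negEffects T) p m d q) :
    Walk T p m (-d) q := by
  induction h with
  | nil p => exact nil p
  | @cons p q r d e m ht _ ih =>
    have ht' : (p, -d, q) ∈ T := ht
    exact (cons ht' ih).cast rfl (by ring)

theorem of_fun {c : ℕ → Q} {η : ℕ → ℤ} {a b : ℕ}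
    (h : ∀ i, a ≤ i → i < b → (c i, η (i + 1) - η i, c (i + 1)) ∈ T) {i j : ℕ}
    (hi : a ≤ i) (hij : i ≤ j) (hj : j ≤ b) : Walk T (c i) (j - i) (η j - η i) (c j) := by
  induction j, hij using Nat.le_induction with
  | base => simpa using nil (T := T) (c i)
  | succ j hij ih =>
    exact ((ih (by omega)).trans (cons (h j (by omega) (by omega)) (nil _))).cast
      (by omega) (by ring)

end Walk

/-- `IsLoop T X a φ`: the set `X` is the set of states of a simple cycle of `T` with effect
`a > 0`, and `φ` describes the counter values along the cycle, modulo `a`. -/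
structure IsLoop (T : Set (Q × ℤ × Q)) (X : Finset Q) (a : ℕ) (φ : Q → ℤ) : Prop where
  pos : 0 < a
  le_card : a ≤ X.card
  turn : ∀ x ∈ X, Walk T x X.card a x
  move : ∀ x ∈ X, ∀ y ∈ X, ∃ m ≤ X.card, ∃ e : ℤ, Walk T x m e y ∧
    (a : ℤ) ∣ e - (φ y - φ x) ∧ a - (X.card : ℤ) ≤ 2 * e ∧ 2 * e ≤ a + X.card

/-- The bounds in `move` come from estimating an arc twice: its effect is at most its length in
absolute value, and so is `a` minus its effect with respect to the complementary arc. Adding the two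
estimates eliminates the unknown arc length. An arc through the base point changes the potential
difference by `a`, whence the congruence. -/
theorem isLoop_of_injOn (hT : SmallEffects T) {c : ℕ → Q} {η : ℕ → ℤ} {m : ℕ} [DecidableEq Q]
    (h : ∀ i < m, (c i, η (i + 1) - η i, c (i + 1)) ∈ T) (hc : c m = c 0) (hη : η 0 < η m)
    (hinj : ∀ i < m, ∀ j < m, c i = c j → i = j) :
    ∃ (a : ℕ) (φ : Q → ℤ), IsLoop T ((Finset.range m).image c) a φ := by
  have hcard : ((Finset.range m).image c).card = m := by
    rw [Finset.card_image_of_injOn, Finset.card_range]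
    intro i hi j hj hij
    exact hinj i (by simpa using hi) j (by simpa using hj) hij
  have hw : ∀ i j, i ≤ j → j ≤ m → Walk T (c i) (j - i) (η j - η i) (c j) := fun i j h1 h2 =>
    Walk.of_fun (a := 0) (fun i _ hi => h i hi) (Nat.zero_le i) h1 h2
  have habs : ∀ i j, i ≤ j → j ≤ m → |η j - η i| ≤ (j : ℤ) - i := fun i j h1 h2 => by
    have := (hw i j h1 h2).abs_le hT
    rwa [Nat.cast_sub h1] at this
  obtain ⟨a, ha⟩ := Int.eq_ofNat_of_zero_le (sub_nonneg.2 hη.le)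
  have hidx : ∀ x : Q, ∃ i, x ∈ (Finset.range m).image c → i < m ∧ c i = x := fun x => by
    by_cases hx : x ∈ (Finset.range m).image c
    · obtain ⟨i, hi, hix⟩ := Finset.mem_image.1 hx
      exact ⟨i, fun _ => ⟨by simpa using hi, hix⟩⟩
    · exact ⟨0, fun h => absurd h hx⟩
  choose idx hidx using hidx
  refine ⟨a, fun x => η (idx x), ⟨by omega, ?_, ?_, ?_⟩⟩
  · have := habs 0 m (Nat.zero_le m) le_rfl
    rw [abs_le] at this
    rw [hcard]
    omega
  · intro x hx
    obtain ⟨hi, hix⟩ := hidx x hx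
    have h1 := hw (idx x) m hi.le le_rfl
    have h2 := hw 0 (idx x) (Nat.zero_le _) hi.le
    rw [hc] at h1
    rw [hcard]
    have := (h1.trans h2).cast (l := m) (e := a) (by omega) (by linarith)
    rwa [hix] at this
  · intro x hx y hy
    obtain ⟨hi, hix⟩ := hidx x hx
    obtain ⟨hj, hjy⟩ := hidx y hy
    generalize idx x = i at *
    generalize idx y = j at *
    subst hix hjy
    rw [hcard]
    rcases le_total i j with hij | hij
    · have h1 := abs_le.1 (habs i j hij hj.le)
      have h2 := abs_le.1 (habs 0 i (Nat.zero_le _) hi.le)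
      have h3 := abs_le.1 (habs j m hj.le le_rfl)
      refine ⟨j - i, by omega, _, hw i j hij hj.le, by simp, ?_, ?_⟩ <;> push_cast at * <;> linarith
    · have h1 := abs_le.1 (habs j i hij hi.le)
      have h2 := abs_le.1 (habs 0 j (Nat.zero_le _) hj.le)
      have h3 := abs_le.1 (habs i m hi.le le_rfl)
      have w1 := hw i m hi.le le_rfl
      have w2 := hw 0 j (Nat.zero_le _) hj.le
      rw [hc] at w1
      refine ⟨_, ?_, _, w1.trans w2, ⟨1, by linarith⟩, ?_, ?_⟩
      · omega
      all_goals push_cast at *; linarith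

/-- A repeated state splits a closed walk of positive effect into two shorter closed walks, one of
which again has positive effect. Descending this way ends at a simple cycle that visits only states
of the original walk. -/
theorem exists_isLoop_of_closed (hT : SmallEffects T) (m : ℕ) :
    ∀ (c : ℕ → Q) (η : ℕ → ℤ), (∀ i < m, (c i, η (i + 1) - η i, c (i + 1)) ∈ T) →
      c m = c 0 → η 0 < η m →
      ∃ (X : Finset Q) (a : ℕ) (φ : Q → ℤ), IsLoop T X a φ ∧ ∀ x ∈ X, ∃ i < m, c i = x := by
  classical
  induction m using Nat.strong_induction_on with
  | _ m ih =>
    intro c η h hc hη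
    by_cases hinj : ∀ i < m, ∀ j < m, c i = c j → i = j
    · obtain ⟨a, φ, hl⟩ := isLoop_of_injOn hT h hc hη hinj
      exact ⟨_, a, φ, hl, fun x hx => by simpa using hx⟩
    · have : ∃ i j, i < j ∧ j < m ∧ c i = c j := by
        push Not at hinj
        obtain ⟨i, hi, j, hj, hij, hne⟩ := hinj
        rcases lt_or_gt_of_ne hne with h1 | h1
        · exact ⟨i, j, h1, hj, hij⟩
        · exact ⟨j, i, h1, hi, hij.symm⟩
      obtain ⟨i, j, hij, hj, hcij⟩ := this
      rcases lt_or_ge (η i) (η j) with hlt | hge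
      · obtain ⟨X, a, φ, hl, hX⟩ := ih (j - i) (by omega) (fun k => c (i + k))
          (fun k => η (i + k)) (fun k hk => h (i + k) (by omega))
          (by simp only [Nat.add_zero]; rw [hcij]; congr 1; omega)
          (by simp only [Nat.add_zero]; rwa [Nat.add_sub_cancel' hij.le])
        refine ⟨X, a, φ, hl, fun x hx => ?_⟩
        obtain ⟨k, hk, rfl⟩ := hX x hx
        exact ⟨i + k, by omega, rfl⟩
      -- Cut out the segment from `i` to `j`; its effect is not positive, so shifting the later
      -- values by `η i - η j` leaves a positive total.
      · obtain ⟨X, a, φ, hl, hX⟩ := ih (m - (j - i)) (by omega)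
          (fun k => if k ≤ i then c k else c (k + (j - i)))
          (fun k => if k ≤ i then η k else η (k + (j - i)) + (η i - η j))
          (fun k hk => by
            rcases lt_trichotomy k i with h1 | rfl | h1
            · simpa [h1.le, Nat.succ_le_of_lt h1] using h k (by omega)
            · have := h j hj
              simp only [le_refl, if_true, Nat.not_succ_le_self, if_false]
              rw [show k + 1 + (j - k) = j + 1 by omega, hcij]
              convert this using 3
              ring
            · have := h (k + (j - i)) (by omega)
              rw [if_neg (by omega), if_neg (by omega), if_neg (by omega), if_neg (by omega),
                show k + 1 + (j - i) = k + (j - i) + 1 by omega]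
              convert this using 3
              ring)
          (by
            rw [if_neg (by omega), if_pos (Nat.zero_le i),
              show m - (j - i) + (j - i) = m by omega, hc])
          (by
            rw [if_pos (Nat.zero_le i), if_neg (by omega),
              show m - (j - i) + (j - i) = m by omega]
            linarith)
        refine ⟨X, a, φ, hl, fun x hx => ?_⟩
        obtain ⟨k, hk, rfl⟩ := hX x hx
        by_cases h1 : k ≤ i
        · exact ⟨k, by omega, by simp [h1]⟩
        · exact ⟨k + (j - i), by omega, by simp [h1]⟩

/-- A maximal family of loops with pairwise disjoint sets of states. -/
structure LoopFamily (T : Set (Q × ℤ × Q)) where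
  /-- the index set -/
  ι : Type v
  fintype : Fintype ι
  /-- the set of states of a loop -/
  supp : ι → Finset Q
  /-- the effect of a loop -/
  eff : ι → ℕ
  /-- the counter values along a loop -/
  pot : ι → Q → ℤ
  isLoop : ∀ i, IsLoop T (supp i) (eff i) (pot i)
  disjoint : ∀ i j, i ≠ j → Disjoint (supp i) (supp j)
  maximal : ∀ X a φ, IsLoop T X a φ → ∃ i, ∃ x ∈ X, x ∈ supp i

attribute [instance] LoopFamily.fintype

/-- Take a disjoint family with the most members: a loop missing all its supports could be added. -/
theorem nonempty_loopFamily [Fintype Q] (T : Set (Q × ℤ × Q)) : Nonempty (LoopFamily T) := by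
  classical
  let P : Finset (Finset (Finset Q)) := Finset.univ.filter fun F =>
    (∀ X ∈ F, ∃ a φ, IsLoop T X a φ) ∧ ∀ X ∈ F, ∀ Y ∈ F, X ≠ Y → Disjoint X Y
  have hP : P.Nonempty := ⟨∅, by simp [P]⟩
  obtain ⟨F, hF, hmax⟩ := P.exists_max_image Finset.card hP
  obtain ⟨hloop, hdisj⟩ : (∀ X ∈ F, ∃ a φ, IsLoop T X a φ) ∧
    ∀ X ∈ F, ∀ Y ∈ F, X ≠ Y → Disjoint X Y := by simpa [P] using hF
  choose a φ hl using fun X : F => hloop X.1 X.2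
  refine ⟨⟨F, inferInstance, fun X => X.1, a, φ, hl,
    fun X Y h => hdisj _ X.2 _ Y.2 (fun h' => h (Subtype.ext h')), fun X b ψ hX => ?_⟩⟩
  by_contra hcon
  push Not at hcon
  have hd : ∀ Y ∈ F, Disjoint X Y := fun Y hY =>
    Finset.disjoint_left.2 fun x hx hxY => hcon ⟨Y, hY⟩ x hx hxY
  have hne : X.Nonempty := Finset.card_pos.1 (hX.pos.trans_le hX.le_card)
  have hXF : X ∉ F := fun h => by
    obtain ⟨x, hx⟩ := hne
    exact Finset.disjoint_left.1 (hd X h) hx hx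
  have := hmax (insert X F) (by
    simp only [P, Finset.mem_filter, Finset.mem_univ, true_and, Finset.mem_insert]
    refine ⟨?_, ?_⟩
    · rintro Y (rfl | hY)
      · exact ⟨b, ψ, hX⟩
      · exact hloop Y hY
    · rintro Y (rfl | hY) Z (rfl | hZ) hYZ
      · exact absurd rfl hYZ
      · exact hd Z hZ
      · exact (hd Y hY).symm
      · exact hdisj Y hY Z hZ hYZ)
  rw [Finset.card_insert_of_notMem hXF] at this
  omega

theorem LoopFamily.sum_card_le [Fintype Q] (A : LoopFamily T) :
    ∑ i, (A.supp i).card ≤ Fintype.card Q := by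
  classical
  rw [← Finset.card_biUnion (fun i _ j _ h => A.disjoint i j h)]
  exact Finset.card_le_univ _

theorem exists_state_eq_of_rise [Fintype Q] (hT : SmallEffects T) {c : ℕ → Q} {η : ℕ → ℤ}
    {u v : ℕ} (huv : u ≤ v)
    (h : ∀ i, u ≤ i → i < v → (c i, η (i + 1) - η i, c (i + 1)) ∈ T)
    (hη : η u + Fintype.card Q ≤ η v) :
    ∃ i j, u ≤ i ∧ i < j ∧ j ≤ v ∧ c i = c j ∧ η i < η j := by
  -- Effects are at most one, so each of the `card Q + 1` levels is hit exactly at the first time it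
  -- is reached; two of these times share a state.
  have hex : ∀ k : Fin (Fintype.card Q + 1), ∃ t, u ≤ t ∧ t ≤ v ∧ η t = η u + k ∧
      ∀ i, u ≤ i → i < t → η i < η u + k := by
    intro k
    obtain ⟨t, h1, h2, h3, h4⟩ := Nat.exists_first (P := fun t => η u + k ≤ η t) huv
      (by have := k.2; omega)
    refine ⟨t, h1, h2, ?_, fun i hi hit => not_le.1 (h4 i hi hit)⟩
    rcases h1.eq_or_lt with rfl | hlt
    · omega
    · have h5 := h4 (t - 1) (by omega) (by omega)
      have h6 := hT _ _ _ (h (t - 1) (by omega) (by omega))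
      rw [Nat.sub_add_cancel (by omega), abs_le] at h6
      omega
  choose τ h1 h2 h3 h4 using hex
  obtain ⟨k, l, hkl, hc⟩ := Fintype.exists_ne_map_eq_of_card_lt (fun k => c (τ k)) (by simp)
  have key : ∀ k l, k < l → τ k < τ l ∧ η (τ k) < η (τ l) := fun k l hkl => by
    have h5 : (k : ℕ) < l := hkl
    have h6 : η (τ k) < η (τ l) := by rw [h3, h3]; omega
    refine ⟨?_, h6⟩
    by_contra hle
    rcases (not_lt.1 hle).eq_or_lt with he | hlt
    · rw [he] at h6; exact lt_irrefl _ h6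
    · have := h4 k (τ l) (h1 l) hlt
      have h7 := h3 k
      omega
  rcases lt_or_gt_of_ne hkl with hlt | hlt
  · exact ⟨τ k, τ l, h1 k, (key _ _ hlt).1, h2 l, hc, (key _ _ hlt).2⟩
  · exact ⟨τ l, τ k, h1 l, (key _ _ hlt).1, h2 k, hc.symm, (key _ _ hlt).2⟩

/-- The two half-open forms matter: an entry must happen strictly before the value reaches 2n, an
exit strictly after it last does. Both are available because the repeated state can be read at
either end of the closed walk. -/
theorem LoopFamily.exists_mem_of_rise [Fintype Q] (hT : SmallEffects T) (A : LoopFamily T)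
    {c : ℕ → Q} {η : ℕ → ℤ} {u v : ℕ} (huv : u ≤ v)
    (h : ∀ i, u ≤ i → i < v → (c i, η (i + 1) - η i, c (i + 1)) ∈ T)
    (hη : η u + Fintype.card Q ≤ η v) :
    ∃ X, (∃ s, u ≤ s ∧ s < v ∧ c s ∈ A.supp X) ∧ ∃ s, u < s ∧ s ≤ v ∧ c s ∈ A.supp X := by
  obtain ⟨i, j, hui, hij, hjv, hc, hlt⟩ := exists_state_eq_of_rise hT huv h hη
  obtain ⟨X, a, φ, hl, hX⟩ := exists_isLoop_of_closed hT (j - i) (fun k => c (i + k))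
    (fun k => η (i + k)) (fun k hk => h (i + k) (by omega) (by omega))
    (by simp only [Nat.add_zero]; rw [hc]; congr 1; omega)
    (by simp only [Nat.add_zero]; rwa [Nat.add_sub_cancel' hij.le])
  obtain ⟨Y, x, hxX, hxY⟩ := A.maximal X a φ hl
  obtain ⟨k, hk, rfl⟩ := hX x hxX
  refine ⟨Y, ⟨i + k, by omega, by omega, hxY⟩, ?_⟩
  rcases Nat.eq_zero_or_pos k with rfl | hk0
  · exact ⟨j, by omega, hjv, by simpa [hc] using hxY⟩
  · exact ⟨i + k, by omega, by omega, hxY⟩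

end Walks


/-! ### The compressed configuration graph and the compression of runs. -/

namespace OneCounterSystem

variable {Q : Type v} (S : OneCounterSystem Q)

theorem smallEffects : SmallEffects S.nonzeroTransitions := fun p d q h => by
  have := S.nonzero_effect _ h
  simp only [Set.mem_insert_iff, Set.mem_singleton_iff] at this
  rcases this with rfl | rfl | rfl <;> simp

/-- One step of the system between configurations. -/
def Step (γ γ' : Q × ℕ) : Prop := ∃ t, S.Fires t γ γ'

variable {S}

theorem Step.abs_le {γ γ' : Q × ℕ} (h : S.Step γ γ') : |(γ'.2 : ℤ) - γ.2| ≤ 1 := by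
  obtain ⟨t, ht, -, -, he⟩ := h
  have : t.2.1 ∈ ({-1, 0, 1} : Set ℤ) := by
    rcases ht with ⟨-, ht⟩ | ⟨-, ht⟩
    · exact S.nonzero_effect _ ht
    · have := S.zero_effect _ ht
      simp only [Set.mem_insert_iff, Set.mem_singleton_iff] at this ⊢
      tauto
  rw [he, add_sub_cancel_left]
  simp only [Set.mem_insert_iff, Set.mem_singleton_iff] at this
  rcases this with h | h | h <;> simp [h]

theorem Step.mem {γ γ' : Q × ℕ} (h : S.Step γ γ') (h0 : 1 ≤ γ.2) :
    (γ.1, (γ'.2 : ℤ) - γ.2, γ'.1) ∈ S.nonzeroTransitions := by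
  obtain ⟨t, ht, h1, h2, he⟩ := h
  have : t ∈ S.nonzeroTransitions := by
    rcases ht with ⟨-, ht⟩ | ⟨h0', -⟩
    · exact ht
    · omega
  rw [h1, h2, he, add_sub_cancel_left]
  exact this

theorem step_of_mem {p q : Q} {d : ℤ} (h : (p, d, q) ∈ S.nonzeroTransitions) {c c' : ℕ}
    (hc : 1 ≤ c) (hc' : (c' : ℤ) = c + d) : S.Step (p, c) (q, c') :=
  ⟨_, Or.inl ⟨hc, h⟩, rfl, rfl, hc'⟩

theorem exists_isPath {k : ℕ} {γ γ' : Q × ℕ} (h : StepsIn S.Step k γ γ') :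
    ∃ σ, S.IsPath γ σ γ' ∧ σ.length = k := by
  induction h with
  | refl a => exact ⟨[], .nil a, rfl⟩
  | head hr _ ih =>
    obtain ⟨t, ht⟩ := hr
    obtain ⟨σ, hσ, hl⟩ := ih
    exact ⟨t :: σ, .cons ht hσ, by simp [hl]⟩

theorem IsPath.stepsIn {γ γ' : Q × ℕ} {σ} (h : S.IsPath γ σ γ') :
    StepsIn S.Step σ.length γ γ' := by
  induction h with
  | nil γ => exact .refl γ
  | cons ht _ ih => exact .head ⟨_, ht⟩ ih

variable (S) in
/-- Vertices of the compressed configuration graph: configurations with small counter values,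
and states in an excursion to large counter values, where the counter value `η` only matters
modulo the effects of the loops `X` and `Y`. -/
inductive Vert (A : LoopFamily S.nonzeroTransitions)
    (B : LoopFamily (negEffects S.nonzeroTransitions)) : Type v
  | low (z : Q) (h : ℕ)
  | high (z : Q) (X : A.ι) (Y : B.ι) (η : ℤ)

variable {A : LoopFamily S.nonzeroTransitions} {B : LoopFamily (negEffects S.nonzeroTransitions)}

/-- The entry condition of an excursion. -/
structure Entry [Fintype Q] (A : LoopFamily S.nonzeroTransitions) (x : Q) (h : ℕ) (x' : Q)
    (X : A.ι) (η : ℤ) : Prop where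
  mem : x ∈ A.supp X
  mem' : x' ∈ A.supp X
  le : Fintype.card Q ≤ h
  lt : h < 2 * Fintype.card Q
  dvd : (A.eff X : ℤ) ∣ η - h - (A.pot X x' - A.pot X x)

/-- The exit condition of an excursion. -/
structure Exit [Fintype Q] (B : LoopFamily (negEffects S.nonzeroTransitions)) (y' : Q) (Y : B.ι)
    (η : ℤ) (y : Q) (h : ℕ) : Prop where
  mem' : y' ∈ B.supp Y
  mem : y ∈ B.supp Y
  le : Fintype.card Q ≤ h
  lt : h < 2 * Fintype.card Q
  dvd : (B.eff Y : ℤ) ∣ η - h - (B.pot Y y - B.pot Y y')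

variable (A B) in
/-- The edges of the compressed configuration graph. -/
inductive Edge [Fintype Q] : Vert S A B → Vert S A B → Prop
  | low {z z' : Q} {h h' : ℕ} : S.Step (z, h) (z', h') → h < 2 * Fintype.card Q →
      h' < 2 * Fintype.card Q → Edge (.low z h) (.low z' h')
  | entry {x x' : Q} {h : ℕ} {X : A.ι} {Y : B.ι} {η : ℤ} : Entry A x h x' X η →
      Edge (.low x h) (.high x' X Y η)
  | walk {z z' : Q} {X : A.ι} {Y : B.ι} {η d : ℤ} : (z, d, z') ∈ S.nonzeroTransitions →
      Edge (.high z X Y η) (.high z' X Y (η + d))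
  | exit {y y' : Q} {h : ℕ} {X : A.ι} {Y : B.ι} {η : ℤ} : Exit B y' Y η y h →
      Edge (.high y' X Y η) (.low y h)

section Compress

variable [Fintype Q] {f : ℕ → Q × ℕ} {L : ℕ}

theorem reflTransGen_low (hf : ∀ i < L, S.Step (f i) (f (i + 1))) {i j : ℕ} (hij : i ≤ j)
    (hj : j ≤ L) (h : ∀ t, i ≤ t → t ≤ j → (f t).2 < 2 * Fintype.card Q) :
    Relation.ReflTransGen (Edge A B) (.low (f i).1 (f i).2) (.low (f j).1 (f j).2) := by
  induction j, hij using Nat.le_induction with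
  | base => exact .refl
  | succ j hij ih =>
    exact (ih (by omega) fun t h1 h2 => h t h1 (by omega)).tail
      (.low (hf j (by omega)) (h j hij (by omega)) (h (j + 1) (by omega) le_rfl))

theorem reflTransGen_high (hf : ∀ i < L, S.Step (f i) (f (i + 1))) {i j : ℕ} (hij : i ≤ j)
    (hj : j ≤ L) (h : ∀ t, i ≤ t → t < j → 1 ≤ (f t).2) (X : A.ι) (Y : B.ι) :
    Relation.ReflTransGen (Edge A B) (.high (f i).1 X Y (f i).2) (.high (f j).1 X Y (f j).2) := by
  induction j, hij using Nat.le_induction with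
  | base => exact .refl
  | succ j hij ih =>
    have := Edge.walk (A := A) (B := B) (X := X) (Y := Y) (η := (f j).2)
      ((hf j (by omega)).mem (h j hij (by omega)))
    rw [add_sub_cancel] at this
    exact (ih (by omega) fun t h1 h2 => h t h1 (by omega)).tail this

/-- If the value reaches 2n, enter at a loop met before the first such time and leave at one met
after the last. Both congruences then hold trivially, with the true counter value as η and no move
along either loop. -/
theorem reflTransGen_excursion (hf : ∀ i < L, S.Step (f i) (f (i + 1))) {u t : ℕ} (hut : u ≤ t)
    (ht : t ≤ L) (hu : (f u).2 = Fintype.card Q) (ht' : (f t).2 = Fintype.card Q)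
    (h : ∀ i, u ≤ i → i ≤ t → Fintype.card Q ≤ (f i).2) :
    Relation.ReflTransGen (Edge A B) (.low (f u).1 (f u).2) (.low (f t).1 (f t).2) := by
  have hn : 0 < Fintype.card Q := Fintype.card_pos_iff.2 ⟨(f 0).1⟩
  by_cases hlow : ∀ i, u ≤ i → i ≤ t → (f i).2 < 2 * Fintype.card Q
  · exact reflTransGen_low hf hut ht hlow
  push Not at hlow
  obtain ⟨i, hui, hit, hi⟩ := hlow
  obtain ⟨a, ha1, ha2, ha3, ha4⟩ :=
    Nat.exists_first (P := fun i => 2 * Fintype.card Q ≤ (f i).2) hui hi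
  obtain ⟨b, hb1, hb2, hb3, hb4⟩ :=
    Nat.exists_last (P := fun i => 2 * Fintype.card Q ≤ (f i).2) hit hi
  have hmem : ∀ i, u ≤ i → i < t →
      ((f i).1, ((f (i + 1)).2 : ℤ) - (f i).2, (f (i + 1)).1) ∈ S.nonzeroTransitions :=
    fun i h1 h2 => (hf i (by omega)).mem (hn.trans_le (h i h1 h2.le))
  obtain ⟨X, ⟨s, hs1, hs2, hs3⟩, -⟩ := A.exists_mem_of_rise S.smallEffects (c := fun i => (f i).1)
    (η := fun i => (f i).2) ha1 (fun i h1 h2 => hmem i h1 (by omega)) (by omega)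
  obtain ⟨Y, -, s', hs1', hs2', hs3'⟩ := B.exists_mem_of_rise S.smallEffects.neg
    (c := fun i => (f i).1) (η := fun i => -((f i).2 : ℤ)) hb2
    (fun i h1 h2 => by
      have := hmem i (by omega) h2
      simp only [negEffects, Set.mem_ofPred_eq]
      convert this using 3
      ring) (by omega)
  have r1 := reflTransGen_low (A := A) (B := B) hf hs1 (by omega : s ≤ L)
    fun i h1 h2 => not_le.1 (ha4 i h1 (by omega))
  have r2 := reflTransGen_high (A := A) (B := B) hf (by omega : s ≤ s') (by omega)
    (fun i h1 h2 => hn.trans_le (h i (by omega) (by omega))) X Y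
  have r3 := reflTransGen_low (A := A) (B := B) hf hs2' ht
    fun i h1 h2 => not_le.1 (hb4 i (by omega) (by omega))
  have e1 : Edge A B (.low (f s).1 (f s).2) (.high (f s).1 X Y (f s).2) :=
    .entry ⟨hs3, hs3, h s hs1 (by omega), not_le.1 (ha4 s hs1 hs2), by simp⟩
  have e2 : Edge A B (.high (f s').1 X Y (f s').2) (.low (f s').1 (f s').2) :=
    .exit ⟨hs3', hs3', h s' (by omega) (by omega), not_le.1 (hb4 s' hs1' (by omega)), by simp⟩
  exact (((r1.tail e1).trans r2).tail e2).trans r3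

theorem reflTransGen_of_le_card (hf : ∀ i < L, S.Step (f i) (f (i + 1))) (h0 : (f 0).2 = 0)
    (t : ℕ) : t ≤ L → (f t).2 ≤ Fintype.card Q →
    Relation.ReflTransGen (Edge A B) (.low (f 0).1 (f 0).2) (.low (f t).1 (f t).2) := by
  have hn : 0 < Fintype.card Q := Fintype.card_pos_iff.2 ⟨(f 0).1⟩
  induction t using Nat.strong_induction_on with
  | _ t ih =>
    intro ht hle
    cases t with
    | zero => exact .refl
    | succ s =>
      by_cases hs : (f s).2 ≤ Fintype.card Q
      · exact (ih s (by omega) (by omega) hs).tail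
          (.low (hf s (by omega)) (by omega) (by omega))
      · obtain ⟨u, -, hu2, hu3, hu4⟩ := Nat.exists_last
          (P := fun i => (f i).2 ≤ Fintype.card Q) (Nat.zero_le s) (by omega)
        have hus : u < s := lt_of_le_of_ne hu2 (fun h => hs (h ▸ hu3))
        have h1 := hu4 (u + 1) (by omega) (by omega)
        have h2 := (hf u (by omega)).abs_le
        have h3 := (hf s (by omega)).abs_le
        rw [abs_le] at h2 h3
        have hu5 : (f u).2 = Fintype.card Q := by omega
        have hs5 : (f (s + 1)).2 = Fintype.card Q := by omega
        refine (ih u (by omega) (by omega) hu3).trans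
          (reflTransGen_excursion hf (by omega) ht hu5 hs5 fun i hi1 hi2 => ?_)
        rcases hi1.eq_or_lt with rfl | hi1
        · exact hu5.ge
        · rcases hi2.eq_or_lt with rfl | hi2
          · exact hs5.ge
          · exact (not_le.1 (hu4 i hi1 (by omega))).le

theorem reflTransGen_of_stepsIn {k : ℕ} {p q : Q}
    (h : StepsIn (fun p q => ∃ d, (p, d, q) ∈ S.nonzeroTransitions) k p q) (c : ℕ)
    (hc : k < c) (hc' : c + k < 2 * Fintype.card Q) :
    ∃ c', Relation.ReflTransGen (Edge A B) (.low p c) (.low q c') := by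
  induction h generalizing c with
  | refl a => exact ⟨c, .refl⟩
  | head hr _ ih =>
    obtain ⟨d, hd⟩ := hr
    have hd1 := abs_le.1 (S.smallEffects _ _ _ hd)
    obtain ⟨c1, hc1⟩ := Int.eq_ofNat_of_zero_le (show 0 ≤ c + d by omega)
    obtain ⟨c', h'⟩ := ih c1 (by omega) (by omega)
    exact ⟨c', .head (.low (step_of_mem hd (by omega) hc1.symm) (by omega) (by omega)) h'⟩

/-- Since the final counter value is irrelevant, the part of the run after its last visit to values
at most n may be replaced by a shortest path of states. It has fewer than n steps and starts at
value n, so it stays strictly between 0 and 2n. -/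
theorem exists_reflTransGen_low (hf : ∀ i < L, S.Step (f i) (f (i + 1))) (h0 : (f 0).2 = 0) :
    ∃ c, Relation.ReflTransGen (Edge A B) (.low (f 0).1 0) (.low (f L).1 c) := by
  obtain ⟨u, -, hu2, hu3, hu4⟩ := Nat.exists_last
    (P := fun i => (f i).2 ≤ Fintype.card Q) (Nat.zero_le L) (by omega)
  have r := reflTransGen_of_le_card (A := A) (B := B) hf h0 u hu2 hu3
  rw [h0] at r
  rcases hu2.eq_or_lt with rfl | hlt
  · exact ⟨_, r⟩
  have h1 := hu4 (u + 1) (by omega) (by omega)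
  have h2 := (hf u hlt).abs_le
  rw [abs_le] at h2
  have hn : 0 < Fintype.card Q := Fintype.card_pos_iff.2 ⟨(f 0).1⟩
  have hs := StepsIn.of_fun (r := fun p q => ∃ d, (p, d, q) ∈ S.nonzeroTransitions)
    (f := fun i => (f (u + i)).1) (k := L - u)
    (fun i hi => ⟨_, (hf (u + i) (by omega)).mem (by
      rcases Nat.eq_zero_or_pos i with rfl | hi0
      · simp only [Nat.add_zero]; omega
      · have := hu4 (u + i) (by omega) (by omega)
        omega)⟩) (Nat.zero_le _) le_rfl
  obtain ⟨m, hm, hs⟩ := hs.exists_lt_card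
  simp only [Nat.add_zero, Nat.add_sub_cancel' hlt.le] at hs
  obtain ⟨c, hc⟩ := reflTransGen_of_stepsIn (A := A) (B := B) hs (f u).2 (by omega) (by omega)
  exact ⟨c, r.trans hc⟩

end Compress

end OneCounterSystem


/-! ### Realizing a compressed excursion by an actual run. -/

theorem Int.exists_dvd_sub_of_gcd_dvd {a b : ℕ} {s t : ℤ} (h : (Nat.gcd a b : ℤ) ∣ s - t) :
    ∃ z : ℤ, (a : ℤ) ∣ z - s ∧ (b : ℤ) ∣ z - t := by
  obtain ⟨c, hc⟩ := h
  have hb := Nat.gcd_eq_gcd_ab a b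
  rw [hb] at hc
  refine ⟨s - a * (Nat.gcdA a b * c), ⟨-(Nat.gcdA a b * c), by ring⟩,
    ⟨Nat.gcdB a b * c, ?_⟩⟩
  linear_combination hc

theorem Int.exists_dvd_sub_mem_Ico {a b : ℕ} (ha : 0 < a) (hb : 0 < b) {c : ℤ}
    (h : (Nat.gcd a b : ℤ) ∣ c) (M : ℤ) :
    ∃ z : ℤ, (a : ℤ) ∣ z ∧ (b : ℤ) ∣ z - c ∧ M ≤ z ∧ z < M + Nat.lcm a b := by
  obtain ⟨z, h1, h2⟩ := Int.exists_dvd_sub_of_gcd_dvd (a := a) (b := b) (s := 0) (t := c)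
    (by simpa using h)
  have hl : (0 : ℤ) < Nat.lcm a b := by exact_mod_cast Nat.lcm_pos ha hb
  have hdiv := Int.emod_add_mul_ediv (z - M) (Nat.lcm a b)
  have key : M + (z - M) % (Nat.lcm a b : ℤ) = z - Nat.lcm a b * ((z - M) / Nat.lcm a b) := by
    linarith
  have da : (a : ℤ) ∣ Nat.lcm a b := by exact_mod_cast Nat.dvd_lcm_left a b
  have db : (b : ℤ) ∣ Nat.lcm a b := by exact_mod_cast Nat.dvd_lcm_right a b
  refine ⟨M + (z - M) % (Nat.lcm a b : ℤ), ?_, ?_, ?_, ?_⟩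
  · rw [key]
    exact dvd_sub (by simpa using h1) (da.mul_right _)
  · rw [key, sub_right_comm]
    exact dvd_sub h2 (db.mul_right _)
  · linarith [Int.emod_nonneg (z - M) hl.ne']
  · linarith [Int.emod_lt_of_pos (z - M) hl]

namespace OneCounterSystem

variable {Q : Type v} {S : OneCounterSystem Q}

theorem stepsIn_of_walk_of_le {p q : Q} {m : ℕ} {d : ℤ} (w : Walk S.nonzeroTransitions p m d q) :
    ∀ h h' : ℕ, m ≤ h → (h' : ℤ) = h + d → StepsIn S.Step m (p, h) (q, h') := by
  induction w with
  | nil p =>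
    intro h h' _ he
    obtain rfl : h' = h := by omega
    exact .refl _
  | @cons p q r d e m ht hw ih =>
    intro h h' hm he
    have := abs_le.1 (S.smallEffects _ _ _ ht)
    obtain ⟨c, hc⟩ := Int.eq_ofNat_of_zero_le (show 0 ≤ h + d by omega)
    exact .head (step_of_mem ht (by omega) hc.symm) (ih c h' (by omega) (by omega))

theorem stepsIn_of_walk_of_le_end {p q : Q} {m : ℕ} {d : ℤ}
    (w : Walk S.nonzeroTransitions p m d q) :
    ∀ h h' : ℕ, 1 ≤ h → m ≤ h' → (h' : ℤ) = h + d → StepsIn S.Step m (p, h) (q, h') := by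
  induction w with
  | nil p =>
    intro h h' _ _ he
    obtain rfl : h' = h := by omega
    exact .refl _
  | @cons p q r d e m ht hw ih =>
    intro h h' h1 hm he
    have := abs_le.1 (S.smallEffects _ _ _ ht)
    have := abs_le.1 (hw.abs_le S.smallEffects)
    obtain ⟨c, hc⟩ := Int.eq_ofNat_of_zero_le (show 0 ≤ h + d by omega)
    exact .head (step_of_mem ht (by omega) hc.symm) (ih c h' (by omega) (by omega) (by omega))

/-- `D` is the largest drop below the starting level, so a start above `D` keeps the counter
positive. Both `D` and the rise `D + d` from the lowest point are bounded by the length. -/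
theorem exists_drop_of_walk {p q : Q} {m : ℕ} {d : ℤ}
    (w : Walk S.nonzeroTransitions p m d q) :
    ∃ D : ℕ, D ≤ m ∧ 0 ≤ D + d ∧ D + d ≤ m ∧
      ∀ h h' : ℕ, D < h → (h' : ℤ) = h + d → StepsIn S.Step m (p, h) (q, h') := by
  induction w with
  | nil p =>
    refine ⟨0, le_rfl, le_rfl, le_rfl, fun h h' _ he => ?_⟩
    obtain rfl : h' = h := by omega
    exact .refl _
  | @cons p q r d e m ht hw ih =>
    obtain ⟨D, h1, h2, h3, h4⟩ := ih
    have := abs_le.1 (S.smallEffects _ _ _ ht)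
    refine ⟨(D - d).toNat, by omega, by omega, by omega, fun h h' hh he => ?_⟩
    obtain ⟨c, hc⟩ := Int.eq_ofNat_of_zero_le (show 0 ≤ h + d by omega)
    exact .head (step_of_mem ht (by omega) hc.symm) (h4 c h' (by omega) (by omega))

theorem stepsIn_turns_up {X : Finset Q} {a : ℕ} {φ : Q → ℤ}
    (hX : IsLoop S.nonzeroTransitions X a φ) {x : Q} (hx : x ∈ X) {h : ℕ} (hh : X.card ≤ h)
    (k : ℕ) : StepsIn S.Step (k * X.card) (x, h) (x, h + k * a) := by
  induction k with
  | zero => simpa using StepsIn.refl (r := S.Step) (x, h)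
  | succ k ih =>
    have := stepsIn_of_walk_of_le (hX.turn x hx) (h + k * a) (h + (k + 1) * a) (by omega)
      (by push_cast; ring)
    exact (ih.trans this).cast (by ring)

theorem stepsIn_turns_down {Y : Finset Q} {b : ℕ} {φ : Q → ℤ}
    (hY : IsLoop (negEffects S.nonzeroTransitions) Y b φ) {y : Q} (hy : y ∈ Y) {h : ℕ}
    (hh : Y.card ≤ h) (l : ℕ) : StepsIn S.Step (l * Y.card) (y, h + l * b) (y, h) := by
  induction l with
  | zero => simpa using StepsIn.refl (r := S.Step) (y, h)
  | succ l ih =>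
    have h0 := Finset.card_pos.2 ⟨y, hy⟩
    have := stepsIn_of_walk_of_le_end (hY.turn y hy).of_neg (h + (l + 1) * b) (h + l * b)
      (by omega) (by omega) (by push_cast; ring)
    exact (this.trans ih).cast (by ring)

variable [Fintype Q] {A : LoopFamily S.nonzeroTransitions}
  {B : LoopFamily (negEffects S.nonzeroTransitions)}

/-- The cost of entering an excursion. -/
def entryCost (A : LoopFamily S.nonzeroTransitions)
    (B : LoopFamily (negEffects S.nonzeroTransitions)) (X : A.ι) (Y : B.ι) : ℚ :=
  (A.supp X).card * (1 + 5 * Fintype.card Q / 2 / A.eff X) +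
    ((A.supp X).card * B.eff Y + (B.supp Y).card * A.eff X) / Nat.gcd (A.eff X) (B.eff Y)

/-- The cost of a step in an excursion. -/
def walkCost (A : LoopFamily S.nonzeroTransitions)
    (B : LoopFamily (negEffects S.nonzeroTransitions)) (X : A.ι) (Y : B.ι) : ℚ :=
  1 + (A.supp X).card / A.eff X + (B.supp Y).card / B.eff Y

/-- The cost of leaving an excursion. -/
def exitCost (B : LoopFamily (negEffects S.nonzeroTransitions)) (Y : B.ι) : ℚ :=
  (B.supp Y).card * (1 + 5 * Fintype.card Q / 2 / B.eff Y)

/-- The run makes `k` turns of X, moves along X to `x'`, follows the walk, moves along Y to `y`, and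
makes `l` turns of Y. Matching the endpoints is one equation in `k` and `l`, solvable by the entry
and exit congruences. -/
theorem exists_stepsIn_excursion {x x' y y' : Q} {h h' m : ℕ} {X : A.ι} {Y : B.ι} {η δ : ℤ}
    (hin : Entry A x h x' X η) (w : Walk S.nonzeroTransitions x' m δ y')
    (hout : Exit B y' Y (η + δ) y h') :
    ∃ k, StepsIn S.Step k (x, h) (y, h') ∧
      (k : ℚ) ≤ entryCost A B X Y + m * walkCost A B X Y + exitCost B Y := by
  have hX := A.isLoop X
  have hY := B.isLoop Y
  have hXn := Finset.card_le_univ (A.supp X)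
  have hYn := Finset.card_le_univ (B.supp Y)
  obtain ⟨m₁, hm₁, e₁, w₁, d₁, l₁, u₁⟩ := hX.move x hin.mem x' hin.mem'
  obtain ⟨m₂, hm₂, e₂, w₂, d₂, l₂, u₂⟩ := hY.move y' hout.mem' y hout.mem
  obtain ⟨D, hDm, hD0, hDm', hD⟩ := exists_drop_of_walk w
  have ha := hX.pos
  have hb := hY.pos
  have hac := hX.le_card
  have hbc := hY.le_card
  have hin1 := hin.le
  have hin2 := hin.lt
  have hout1 := hout.le
  have hout2 := hout.lt
  have hdin := hin.dvd
  have hdout := hout.dvd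
  rw [entryCost, walkCost, exitCost]
  set a := A.eff X
  set b := B.eff Y
  have hg : (Nat.gcd a b : ℤ) ∣ (h' + e₂) - (h + e₁) - δ := by
    have g1 : (Nat.gcd a b : ℤ) ∣ a := by exact_mod_cast Nat.gcd_dvd_left a b
    have g2 : (Nat.gcd a b : ℤ) ∣ b := by exact_mod_cast Nat.gcd_dvd_right a b
    have := dvd_sub (dvd_sub (g1.trans hdin) (g1.trans d₁))
      (dvd_sub (g2.trans hdout) (g2.trans d₂))
    rwa [show (h' + e₂ : ℤ) - (h + e₁) - δ =
      η - h - (A.pot X x' - A.pot X x) - (e₁ - (A.pot X x' - A.pot X x)) -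
      (η + δ - h' - (B.pot Y y - B.pot Y y') - (e₂ - (B.pot Y y - B.pot Y y'))) by ring]
  -- The total climb `a * k` must be at least `D` to keep the walk positive, and large enough that
  -- `l` is nonnegative; a solution exists within one lcm of that threshold.
  obtain ⟨z, ⟨k, rfl⟩, ⟨l, hl⟩, hM, hM'⟩ :=
    Int.exists_dvd_sub_mem_Ico ha hb hg (max D ((h' + e₂) - (h + e₁) - δ))
  obtain ⟨hM1, hM2⟩ := max_le_iff.1 hM
  have ha' : (0 : ℤ) < a := by exact_mod_cast ha
  have hb' : (0 : ℤ) < b := by exact_mod_cast hb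
  obtain ⟨k, rfl⟩ := Int.eq_ofNat_of_zero_le (show 0 ≤ k by
    have : 0 ≤ a * k := by omega
    exact (mul_nonneg_iff_of_pos_left ha').1 this)
  obtain ⟨l, rfl⟩ := Int.eq_ofNat_of_zero_le (show 0 ≤ l by
    have : 0 ≤ b * l := by omega
    exact (mul_nonneg_iff_of_pos_left hb').1 this)
  -- The 5n/2 combines at most n from `h' - h`, n from one of the moves `e₁`, `e₂` and n/2 from the
  -- other; `D` and `-δ` are at most `m`.
  have hk2 : 2 * ((a : ℤ) * k) ≤ 2 * m + 5 * Fintype.card Q + 2 * Nat.lcm a b := by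
    rcases max_cases (D : ℤ) ((h' + e₂) - (h + e₁) - δ) with ⟨h1, h2⟩ | ⟨h1, h2⟩ <;>
      rw [h1] at hM' <;> omega
  have hl2 : 2 * ((b : ℤ) * l) ≤ 2 * m + 5 * Fintype.card Q + 2 * Nat.lcm a b := by
    rcases max_cases (D : ℤ) ((h' + e₂) - (h + e₁) - δ) with ⟨h1, h2⟩ | ⟨h1, h2⟩ <;>
      rw [h1] at hM' <;> omega
  have hak : ((k * a : ℕ) : ℤ) = a * k := by push_cast; ring
  have hbl : ((l * b : ℕ) : ℤ) = b * l := by push_cast; ring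
  obtain ⟨P, hP⟩ := Int.eq_ofNat_of_zero_le (show 0 ≤ h + a * k + e₁ by omega)
  obtain ⟨R, hR⟩ := Int.eq_ofNat_of_zero_le (show 0 ≤ P + δ by omega)
  have s₁ := stepsIn_turns_up hX hin.mem (h := h) (by omega) k
  have s₂ := stepsIn_of_walk_of_le w₁ (h + k * a) P (by omega) (by omega)
  have s₃ := hD P R (by omega) (by omega)
  have s₄ := stepsIn_of_walk_of_le_end w₂.of_neg R (h' + l * b) (by omega) (by omega) (by omega)
  have s₅ := stepsIn_turns_down hY hout.mem (h := h') (by omega) l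
  refine ⟨_, (((s₁.trans s₂).trans s₃).trans s₄).trans s₅, ?_⟩
  have qa : (0 : ℚ) < a := by exact_mod_cast ha
  have qb : (0 : ℚ) < b := by exact_mod_cast hb
  have qg : (0 : ℚ) < Nat.gcd a b := by exact_mod_cast Nat.gcd_pos_of_pos_left b ha
  have hlcm : (Nat.lcm a b : ℚ) = a * b / Nat.gcd a b := by
    rw [eq_div_iff qg.ne', mul_comm]
    exact_mod_cast Nat.gcd_mul_lcm a b
  have hk3 : (k : ℚ) ≤ m / a + 5 * Fintype.card Q / 2 / a + b / Nat.gcd a b := by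
    have : (2 * (a * k) : ℚ) ≤ 2 * m + 5 * Fintype.card Q + 2 * Nat.lcm a b := by
      exact_mod_cast hk2
    rw [hlcm] at this
    have e : (m : ℚ) / a + 5 * Fintype.card Q / 2 / a + b / Nat.gcd a b =
      (m + 5 * Fintype.card Q / 2 + a * b / Nat.gcd a b) / a := by field_simp
    rw [e, le_div_iff₀ qa]
    linarith
  have hl3 : (l : ℚ) ≤ m / b + 5 * Fintype.card Q / 2 / b + a / Nat.gcd a b := by
    have : (2 * (b * l) : ℚ) ≤ 2 * m + 5 * Fintype.card Q + 2 * Nat.lcm a b := by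
      exact_mod_cast hl2
    rw [hlcm] at this
    have e : (m : ℚ) / b + 5 * Fintype.card Q / 2 / b + a / Nat.gcd a b =
      (m + 5 * Fintype.card Q / 2 + a * b / Nat.gcd a b) / b := by field_simp
    rw [e, le_div_iff₀ qb]
    linarith
  have hm₁' : (m₁ : ℚ) ≤ (A.supp X).card := by exact_mod_cast hm₁
  have hm₂' : (m₂ : ℚ) ≤ (B.supp Y).card := by exact_mod_cast hm₂
  have hk4 := mul_le_mul_of_nonneg_right hk3 (Nat.cast_nonneg (α := ℚ) (A.supp X).card)
  have hl4 := mul_le_mul_of_nonneg_right hl3 (Nat.cast_nonneg (α := ℚ) (B.supp Y).card)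
  push_cast
  refine (add_le_add (add_le_add (add_le_add (add_le_add hk4 hm₁') le_rfl) hm₂') hl4).trans
    (le_of_eq ?_)
  ring

end OneCounterSystem


/-! ### Shortcuts on shortest compressed paths. -/

namespace OneCounterSystem

variable {Q : Type v} {S : OneCounterSystem Q} [Fintype Q] {A : LoopFamily S.nonzeroTransitions}
  {B : LoopFamily (negEffects S.nonzeroTransitions)}

/-- The cost of realizing an edge of the compressed configuration graph. -/
def edgeCost : Vert S A B → Vert S A B → ℚ
  | .low _ _, .low _ _ => 1
  | .low _ _, .high _ X Y _ => entryCost A B X Y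
  | .high _ X Y _, .high _ _ _ _ => walkCost A B X Y
  | .high _ X Y _, .low _ _ => walkCost A B X Y + exitCost B Y

variable {f : ℕ → Vert S A B} {M : ℕ}

theorem exists_entry (hf : ∀ i < M, Edge A B (f i) (f (i + 1))) {p : Q} {c : ℕ}
    (h0 : f 0 = .low p c) {t : ℕ} (ht : t ≤ M) {z : Q} {X : A.ι} {Y : B.ι} {η : ℤ}
    (h : f t = .high z X Y η) :
    ∃ e < t, ∃ x h x' η₀, f e = .low x h ∧ f (e + 1) = .high x' X Y η₀ ∧ Entry A x h x' X η₀ ∧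
      Walk S.nonzeroTransitions x' (t - (e + 1)) (η - η₀) z ∧
      ∀ s, e < s → s ≤ t → ∃ z η, f s = .high z X Y η := by
  induction t generalizing z η with
  | zero => rw [h0] at h; cases h
  | succ t ih =>
    have hE := hf t (by omega)
    rw [h] at hE
    generalize hv : f t = v at hE
    cases hE with
    | @entry x x' k X Y η hen =>
      refine ⟨t, by omega, x, k, z, η, hv, h, hen, by simpa using Walk.nil z, fun s h1 h2 => ?_⟩
      obtain rfl : s = t + 1 := by omega
      exact ⟨_, _, h⟩
    | @walk z₀ z' X Y η₁ d hw =>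
      obtain ⟨e, he, x, k, x', η₀, h1, h2, h3, h4, h5⟩ := ih (by omega) hv
      refine ⟨e, by omega, x, k, x', η₀, h1, h2, h3,
        (h4.trans (.cons hw (.nil _))).cast (by omega) (by ring), fun s h6 h7 => ?_⟩
      rcases h7.eq_or_lt with rfl | h7
      · exact ⟨_, _, h⟩
      · exact h5 s h6 (by omega)

theorem exists_exit (hf : ∀ i < M, Edge A B (f i) (f (i + 1))) {p : Q} {c : ℕ}
    (hM : f M = .low p c) {t : ℕ} (ht : t ≤ M) {z : Q} {X : A.ι} {Y : B.ι} {η : ℤ}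
    (h : f t = .high z X Y η) :
    ∃ l, t ≤ l ∧ l < M ∧ ∃ y' η₁ y h, f l = .high y' X Y η₁ ∧ f (l + 1) = .low y h ∧
      Exit B y' Y η₁ y h ∧ Walk S.nonzeroTransitions z (l - t) (η₁ - η) y' := by
  induction ht using Nat.decreasingInduction generalizing z η with
  | self => rw [hM] at h; cases h
  | of_succ t ht ih =>
    have hE := hf t ht
    rw [h] at hE
    generalize hv : f (t + 1) = v at hE
    cases hE with
    | @exit y' y k X Y η hex =>
      exact ⟨t, le_rfl, ht, z, η, _, _, h, hv, hex, by simpa using Walk.nil z⟩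
    | @walk z₀ z' X Y η₁ d hw =>
      obtain ⟨l, hl, hlM, y', η₂, y, k, h1, h2, h3, h4⟩ := ih hv
      exact ⟨l, by omega, hlM, y', η₂, y, k, h1, h2, h3,
        (Walk.cons hw h4).cast (by omega) (by ring)⟩

theorem stepsIn_high {p q : Q} {m : ℕ} {d : ℤ} (w : Walk S.nonzeroTransitions p m d q)
    (X : A.ι) (Y : B.ι) (η : ℤ) :
    StepsIn (Edge A B) m (.high p X Y η) (.high q X Y (η + d)) := by
  induction w generalizing η with
  | nil p => simpa using StepsIn.refl (r := Edge A B) (.high p X Y η)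
  | cons ht _ ih =>
    rw [← add_assoc]
    exact .head (.walk ht) (ih _)

/-- The initial value is constrained modulo `eff X` by the entry and modulo `eff Y` by the exit.
These are compatible when the discrepancy is divisible by the gcd, so entry and exit may come from
different excursions. -/
theorem stepsIn_excursion {x x' y y' : Q} {h h' m : ℕ} {X : A.ι} {Y : B.ι} {η₀ η₁ δ : ℤ}
    (hin : Entry A x h x' X η₀) (w : Walk S.nonzeroTransitions x' m δ y')
    (hout : Exit B y' Y η₁ y h')
    (hg : (Nat.gcd (A.eff X) (B.eff Y) : ℤ) ∣ η₀ + δ - η₁) :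
    StepsIn (Edge A B) (m + 2) (.low x h) (.low y h') := by
  obtain ⟨η, h1, h2⟩ := Int.exists_dvd_sub_of_gcd_dvd (s := η₀) (t := η₁ - δ)
    (by rwa [show η₀ - (η₁ - δ) = η₀ + δ - η₁ by ring])
  have hin' : Entry A x h x' X η := ⟨hin.mem, hin.mem', hin.le, hin.lt, by
    have := dvd_add h1 hin.dvd
    rwa [show η - η₀ + (η₀ - h - (A.pot X x' - A.pot X x)) =
      η - h - (A.pot X x' - A.pot X x) by ring] at this⟩
  have hout' : Exit B y' Y (η + δ) y h' := ⟨hout.mem', hout.mem, hout.le, hout.lt, by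
    have := dvd_add h2 hout.dvd
    rwa [show η - (η₁ - δ) + (η₁ - h' - (B.pot Y y - B.pot Y y')) =
      η + δ - h' - (B.pot Y y - B.pot Y y') by ring] at this⟩
  exact (StepsIn.head (.entry hin') ((stepsIn_high w X Y η).trans (.single (.exit hout')))).cast
    (by omega)

theorem Entry.move {x x' x'' : Q} {h : ℕ} {X : A.ι} {η : ℤ} (hin : Entry A x h x' X η)
    (hx : x'' ∈ A.supp X) : Entry A x h x'' X (η - A.pot X x' + A.pot X x'') :=
  ⟨hin.mem, hx, hin.le, hin.lt, by
    have := hin.dvd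
    rwa [show η - A.pot X x' + A.pot X x'' - h - (A.pot X x'' - A.pot X x) =
      η - h - (A.pot X x' - A.pot X x) by ring]⟩

theorem Exit.move {y y' y'' : Q} {h : ℕ} {Y : B.ι} {η : ℤ} (hout : Exit B y' Y η y h)
    (hy : y'' ∈ B.supp Y) : Exit B y'' Y (η + B.pot Y y' - B.pot Y y'') y h :=
  ⟨hy, hout.mem, hout.le, hout.lt, by
    have := hout.dvd
    rwa [show η + B.pot Y y' - B.pot Y y'' - h - (B.pot Y y - B.pot Y y'') =
      η - h - (B.pot Y y - B.pot Y y') by ring]⟩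

/-- A shortest path in the compressed configuration graph, between small counter values. -/
structure IsShortest (f : ℕ → Vert S A B) (M : ℕ) : Prop where
  start : ∃ p c, f 0 = .low p c
  finish : ∃ q c, f M = .low q c
  edge : ∀ i < M, Edge A B (f i) (f (i + 1))
  le : ∀ i j l, i ≤ j → j ≤ M → StepsIn (Edge A B) l (f i) (f j) → j - i ≤ l

namespace IsShortest

variable (hs : IsShortest f M)
include hs

theorem exists_entry {t : ℕ} (ht : t ≤ M) {z : Q} {X : A.ι} {Y : B.ι} {η : ℤ}
    (h : f t = .high z X Y η) :
    ∃ e < t, ∃ x h x' η₀, f e = .low x h ∧ f (e + 1) = .high x' X Y η₀ ∧ Entry A x h x' X η₀ ∧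
      Walk S.nonzeroTransitions x' (t - (e + 1)) (η - η₀) z ∧
      ∀ s, e < s → s ≤ t → ∃ z η, f s = .high z X Y η := by
  obtain ⟨p, c, h0⟩ := hs.start
  exact OneCounterSystem.exists_entry hs.edge h0 ht h

theorem exists_exit {t : ℕ} (ht : t ≤ M) {z : Q} {X : A.ι} {Y : B.ι} {η : ℤ}
    (h : f t = .high z X Y η) :
    ∃ l, t ≤ l ∧ l < M ∧ ∃ y' η₁ y h, f l = .high y' X Y η₁ ∧ f (l + 1) = .low y h ∧
      Exit B y' Y η₁ y h ∧ Walk S.nonzeroTransitions z (l - t) (η₁ - η) y' := by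
  obtain ⟨p, c, hM⟩ := hs.finish
  exact OneCounterSystem.exists_exit hs.edge hM ht h

theorem ne_of_lt {i j : ℕ} (hij : i < j) (hj : j ≤ M) : f i ≠ f j := fun h => by
  have := hs.le i j 0 hij.le hj (h ▸ .refl _)
  omega

/-- Otherwise follow the first excursion up to time `i` and continue as from time `j`, keeping the
loop X of the earlier entry and Y' of the later exit. The merged excursion is shorter by `j - i`. -/
theorem not_dvd_of_high {i j : ℕ} (hij : i < j) (hj : j ≤ M) {z : Q} {X X' : A.ι} {Y Y' : B.ι}
    {η η' : ℤ} (hi : f i = .high z X Y η) (hj' : f j = .high z X' Y' η') :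
    ¬ (Nat.gcd (A.eff X) (B.eff Y') : ℤ) ∣ η - η' := fun hd => by
  obtain ⟨e, he, x, h, x', η₀, h1, -, h3, h4, -⟩ := hs.exists_entry (by omega) hi
  obtain ⟨l, hl, hlM, y', η₁, y, h', -, k2, k3, k4⟩ := hs.exists_exit hj hj'
  have := stepsIn_excursion h3 (h4.trans k4) k3
    (by rwa [show η₀ + (η - η₀ + (η₁ - η')) - η₁ = η - η' by ring])
  rw [← h1, ← k2] at this
  have := hs.le e (l + 1) _ (by omega) (by omega) this
  omega

/-- Value minus potential is unchanged when the entry point moves along X. Otherwise the earlier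
entry could be moved to `z'` and continued with the later walk and exit. -/
theorem not_dvd_of_entry {i j : ℕ} (hij : i < j) (hj : j < M) {x z z' w : Q} {c d : ℕ}
    {X : A.ι} {Y Y' : B.ι} {η η' : ℤ} (hi : f i = .low x c) (hi' : f (i + 1) = .high z X Y η)
    (hj₀ : f j = .low w d) (hj' : f (j + 1) = .high z' X Y' η') :
    ¬ (Nat.gcd (A.eff X) (B.eff Y') : ℤ) ∣ (η - A.pot X z) - (η' - A.pot X z') := fun hd => by
  have he := hs.edge i (by omega)
  have he' := hs.edge j hj
  rw [hi, hi'] at he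
  rw [hj₀, hj'] at he'
  cases he with
  | entry hin =>
  cases he' with
  | entry hin' =>
  obtain ⟨l, hl, hlM, y', η₁, y, h', -, k2, k3, k4⟩ := hs.exists_exit (by omega) hj'
  have := stepsIn_excursion (hin.move hin'.mem') k4 k3
    (by rwa [show η - A.pot X z + A.pot X z' + (η₁ - η') - η₁ =
      (η - A.pot X z) - (η' - A.pot X z') by ring])
  rw [← hi, ← k2] at this
  have := hs.le i (l + 1) _ (by omega) (by omega) this
  omega

theorem not_dvd_of_exit {i j : ℕ} (hij : i < j) (hj : j < M) {x z z' w : Q} {c d : ℕ}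
    {X X' : A.ι} {Y : B.ι} {η η' : ℤ} (hi : f i = .high z X Y η) (hi' : f (i + 1) = .low x c)
    (hj₀ : f j = .high z' X' Y η') (hj' : f (j + 1) = .low w d) :
    ¬ (Nat.gcd (A.eff X) (B.eff Y) : ℤ) ∣ (η + B.pot Y z) - (η' + B.pot Y z') := fun hd => by
  have he := hs.edge i (by omega)
  have he' := hs.edge j hj
  rw [hi, hi'] at he
  rw [hj₀, hj'] at he'
  cases he with
  | exit hout =>
  cases he' with
  | exit hout' =>
  obtain ⟨e, he, x, h, x', η₀, h1, -, h3, h4, -⟩ := hs.exists_entry (by omega) hi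
  have := stepsIn_excursion h3 h4 (hout'.move hout.mem')
    (by rwa [show η₀ + (η - η₀) - (η' + B.pot Y z' - B.pot Y z) =
      (η + B.pot Y z) - (η' + B.pot Y z') by ring])
  rw [← h1, ← hj'] at this
  have := hs.le e (j + 1) _ (by omega) (by omega) this
  omega

/-- High vertices are not configurations, so an excursion is realized as a whole when its exit edge
is reached, and the induction resumes from the low vertex before its entry. -/
theorem exists_stepsIn {p : Q} {c : ℕ} (h0 : f 0 = .low p c) (t : ℕ) :
    t ≤ M → ∀ z h, f t = .low z h →
    ∃ k, StepsIn S.Step k (p, c) (z, h) ∧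
      (k : ℚ) ≤ ∑ i ∈ Finset.range t, edgeCost (f i) (f (i + 1)) := by
  induction t using Nat.strong_induction_on with
  | _ t ih =>
    intro htM z h ht
    cases t with
    | zero =>
      rw [h0] at ht
      cases ht
      exact ⟨0, .refl _, by simp⟩
    | succ t =>
      have hE := hs.edge t (by omega)
      rw [ht] at hE
      generalize hv : f t = v at hE
      cases hE with
      | @low z₀ _ h₀ _ hstep _ _ =>
        obtain ⟨k, hk, hk'⟩ := ih t (by omega) (by omega) _ _ hv
        refine ⟨k + 1, hk.trans (.single hstep), ?_⟩
        rw [Finset.sum_range_succ, hv, ht, edgeCost]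
        push_cast
        linarith
      | @exit y' _ _ X Y η hout =>
        obtain ⟨e, het, x, c', x', η₀, h1, h2, h3, h4, h5⟩ := hs.exists_entry (by omega) hv
        obtain ⟨k, hk, hk'⟩ := ih e (by omega) (by omega) _ _ h1
        obtain ⟨l, hl, hl'⟩ := exists_stepsIn_excursion h3 h4
          (by rw [add_sub_cancel]; exact hout)
        refine ⟨k + l, hk.trans hl, ?_⟩
        have hwalk : ∑ i ∈ Finset.Ico (e + 1) t, edgeCost (f i) (f (i + 1)) =
            (t - (e + 1) : ℕ) * walkCost A B X Y := by
          rw [Finset.sum_congr rfl (g := fun _ => walkCost A B X Y), Finset.sum_const,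
            Nat.card_Ico, nsmul_eq_mul]
          intro i hi
          rw [Finset.mem_Ico] at hi
          obtain ⟨z₁, η₁, e1⟩ := h5 i (by omega) (by omega)
          obtain ⟨z₂, η₂, e2⟩ := h5 (i + 1) (by omega) (by omega)
          rw [e1, e2, edgeCost]
        -- The exit edge carries one `walkCost` more than needed; nonnegativity lets it be
        -- discarded.
        have hw0 : 0 ≤ walkCost A B X Y := by unfold walkCost; positivity
        rw [Finset.sum_range_succ, hv, ht, edgeCost,
          ← Finset.sum_range_add_sum_Ico _ (show e + 1 ≤ t by omega), hwalk,
          Finset.sum_range_succ, h1, h2, edgeCost]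
        push_cast
        linarith

end IsShortest

end OneCounterSystem


/-! ### Counting the edges of a shortest path and summing their costs. -/

theorem Finset.card_le_card_of_lt_ne {α : Type*} {s : Finset ℕ} {u : Finset α} (l : ℕ → α)
    (h : ∀ i ∈ s, l i ∈ u) (hl : ∀ i ∈ s, ∀ j ∈ s, i < j → l i ≠ l j) : s.card ≤ u.card :=
  Finset.card_le_card_of_injOn l h fun i hi j hj hij => by
    rcases lt_trichotomy i j with h1 | h1 | h1
    · exact absurd hij (hl i hi j hj h1)
    · exact h1
    · exact absurd hij.symm (hl j hj i hi h1)

section IndicatorSum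

variable {ι : Type*} [Fintype ι]

open Classical in
/-- The sum of the weights `g i` of the indices `i` with `P i t`. -/
noncomputable def indicatorSum (P : ι → ℕ → Prop) (g : ι → ℚ) (t : ℕ) : ℚ :=
  ∑ i, if P i t then g i else 0

variable {P : ι → ℕ → Prop} {g : ι → ℚ}

theorem indicatorSum_nonneg (hg : ∀ i, 0 ≤ g i) (t : ℕ) : 0 ≤ indicatorSum P g t :=
  Finset.sum_nonneg fun i _ => by split_ifs <;> simp [hg]

theorem le_indicatorSum (hg : ∀ i, 0 ≤ g i) {i : ι} {t : ℕ} (h : P i t) :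
    g i ≤ indicatorSum P g t := by
  classical
  calc g i = if P i t then g i else 0 := (if_pos h).symm
    _ ≤ indicatorSum P g t := Finset.single_le_sum (f := fun i => if P i t then g i else 0)
      (fun i _ => by split_ifs <;> simp [hg]) (Finset.mem_univ i)

theorem sum_indicatorSum_le (hg : ∀ i, 0 ≤ g i) {M : ℕ} {c : ι → ℕ}
    (hc : ∀ i (s : Finset ℕ), (∀ t ∈ s, t < M ∧ P i t) → s.card ≤ c i) :
    ∑ t ∈ Finset.range M, indicatorSum P g t ≤ ∑ i, c i * g i := by
  classical
  unfold indicatorSum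
  rw [Finset.sum_comm]
  refine Finset.sum_le_sum fun i _ => ?_
  rw [← Finset.sum_filter, Finset.sum_const, nsmul_eq_mul]
  refine mul_le_mul_of_nonneg_right ?_ (hg i)
  exact_mod_cast hc i _ fun t ht => by simpa using ht

end IndicatorSum

theorem Int.emod_mem_Ico {a : ℕ} (ha : 0 < a) (z : ℤ) : z % a ∈ Finset.Ico (0 : ℤ) a :=
  Finset.mem_Ico.2 ⟨Int.emod_nonneg _ (by omega), Int.emod_lt_of_pos _ (by omega)⟩

namespace OneCounterSystem

variable {Q : Type v} {S : OneCounterSystem Q} [Fintype Q] {A : LoopFamily S.nonzeroTransitions}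
  {B : LoopFamily (negEffects S.nonzeroTransitions)}

/-- The state of a vertex. -/
def Vert.state : Vert S A B → Q
  | .low z _ => z
  | .high z _ _ _ => z

/-- The counter value of a vertex. -/
def Vert.value : Vert S A B → ℤ
  | .low _ h => h
  | .high _ _ _ η => η

variable {f : ℕ → Vert S A B} {M : ℕ}

namespace IsShortest

variable (hs : IsShortest f M)
include hs

theorem card_low_le (s : Finset ℕ)
    (h : ∀ t ∈ s, t < M ∧ ∃ z c, f t = .low z c ∧ c < 2 * Fintype.card Q) :
    s.card ≤ 2 * Fintype.card Q ^ 2 := by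
  have := Finset.card_le_card_of_lt_ne (s := s)
    (u := (Finset.univ : Finset Q) ×ˢ Finset.Ico (0 : ℤ) (2 * Fintype.card Q))
    (fun t => ((f t).state, (f t).value))
    (fun t ht => by
      obtain ⟨-, z, c, h1, h2⟩ := h t ht
      rw [h1]
      simp only [Vert.state, Vert.value, Finset.mem_product, Finset.mem_univ, Finset.mem_Ico,
        true_and]
      omega)
    (fun i hi j hj hij he => by
      obtain ⟨-, z, c, h1, -⟩ := h i hi
      obtain ⟨hj, z', c', h1', -⟩ := h j hj
      simp only [h1, h1', Vert.state, Vert.value, Prod.mk.injEq, Nat.cast_inj] at he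
      exact hs.ne_of_lt hij hj.le (by rw [h1, h1', he.1, he.2]))
  refine this.trans (le_of_eq ?_)
  rw [Finset.card_product, Finset.card_univ, Int.card_Ico]
  have : ((2 * Fintype.card Q : ℤ) - 0).toNat = 2 * Fintype.card Q := by omega
  rw [this]
  ring

theorem card_high_left_le (X : A.ι) (s : Finset ℕ)
    (h : ∀ t ∈ s, t < M ∧ ∃ z Y η, f t = .high z X Y η) :
    s.card ≤ Fintype.card Q * A.eff X := by
  have := Finset.card_le_card_of_lt_ne (s := s)
    (u := (Finset.univ : Finset Q) ×ˢ Finset.Ico (0 : ℤ) (A.eff X))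
    (fun t => ((f t).state, (f t).value % A.eff X))
    (fun t ht => Finset.mem_product.2
      ⟨Finset.mem_univ _, Int.emod_mem_Ico (A.isLoop X).pos _⟩)
    (fun i hi j hj hij he => by
      obtain ⟨-, z, Y, η, h1⟩ := h i hi
      obtain ⟨hj, z', Y', η', h1'⟩ := h j hj
      simp only [h1, h1', Vert.state, Vert.value, Prod.mk.injEq] at he
      obtain ⟨rfl, he⟩ := he
      exact hs.not_dvd_of_high hij hj.le h1 h1' ((Int.natCast_dvd_natCast.2
        (Nat.gcd_dvd_left _ _)).trans (Int.ModEq.dvd he.symm)))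
  simpa using this

theorem card_high_right_le (Y : B.ι) (s : Finset ℕ)
    (h : ∀ t ∈ s, t < M ∧ ∃ z X η, f t = .high z X Y η) :
    s.card ≤ Fintype.card Q * B.eff Y := by
  have := Finset.card_le_card_of_lt_ne (s := s)
    (u := (Finset.univ : Finset Q) ×ˢ Finset.Ico (0 : ℤ) (B.eff Y))
    (fun t => ((f t).state, (f t).value % B.eff Y))
    (fun t ht => Finset.mem_product.2
      ⟨Finset.mem_univ _, Int.emod_mem_Ico (B.isLoop Y).pos _⟩)
    (fun i hi j hj hij he => by
      obtain ⟨-, z, X, η, h1⟩ := h i hi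
      obtain ⟨hj, z', X', η', h1'⟩ := h j hj
      simp only [h1, h1', Vert.state, Vert.value, Prod.mk.injEq] at he
      obtain ⟨rfl, he⟩ := he
      exact hs.not_dvd_of_high hij hj.le h1 h1' ((Int.natCast_dvd_natCast.2
        (Nat.gcd_dvd_right _ _)).trans (Int.ModEq.dvd he.symm)))
  simpa using this

theorem card_entry_le (X : A.ι) (s : Finset ℕ)
    (h : ∀ t ∈ s, t < M ∧ ∃ x c z Y η, f t = .low x c ∧ f (t + 1) = .high z X Y η) :
    s.card ≤ A.eff X := by
  have := Finset.card_le_card_of_lt_ne (s := s) (u := Finset.Ico (0 : ℤ) (A.eff X))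
    (fun t => ((f (t + 1)).value - A.pot X (f (t + 1)).state) % A.eff X)
    (fun t ht => Int.emod_mem_Ico (A.isLoop X).pos _)
    (fun i hi j hj hij he => by
      obtain ⟨-, x, c, z, Y, η, h1, h2⟩ := h i hi
      obtain ⟨hj, x', c', z', Y', η', h1', h2'⟩ := h j hj
      simp only [h2, h2', Vert.state, Vert.value] at he
      exact hs.not_dvd_of_entry hij hj h1 h2 h1' h2' ((Int.natCast_dvd_natCast.2
        (Nat.gcd_dvd_left _ _)).trans (Int.ModEq.dvd he.symm)))
  simpa using this

theorem card_entry_pair_le (X : A.ι) (Y : B.ι) (s : Finset ℕ)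
    (h : ∀ t ∈ s, t < M ∧ ∃ x c z η, f t = .low x c ∧ f (t + 1) = .high z X Y η) :
    s.card ≤ Nat.gcd (A.eff X) (B.eff Y) := by
  have := Finset.card_le_card_of_lt_ne (s := s)
    (u := Finset.Ico (0 : ℤ) (Nat.gcd (A.eff X) (B.eff Y) : ℕ))
    (fun t => ((f (t + 1)).value - A.pot X (f (t + 1)).state) %
      (Nat.gcd (A.eff X) (B.eff Y) : ℕ))
    (fun t ht => Int.emod_mem_Ico (Nat.gcd_pos_of_pos_left _ (A.isLoop X).pos) _)
    (fun i hi j hj hij he => by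
      obtain ⟨-, x, c, z, η, h1, h2⟩ := h i hi
      obtain ⟨hj, x', c', z', η', h1', h2'⟩ := h j hj
      simp only [h2, h2', Vert.state, Vert.value] at he
      exact hs.not_dvd_of_entry hij hj h1 h2 h1' h2' (Int.ModEq.dvd he.symm))
  simpa using this

theorem card_exit_le (Y : B.ι) (s : Finset ℕ)
    (h : ∀ t ∈ s, t < M ∧ ∃ x c z X η, f t = .high z X Y η ∧ f (t + 1) = .low x c) :
    s.card ≤ B.eff Y := by
  have := Finset.card_le_card_of_lt_ne (s := s) (u := Finset.Ico (0 : ℤ) (B.eff Y))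
    (fun t => ((f t).value + B.pot Y (f t).state) % B.eff Y)
    (fun t ht => Int.emod_mem_Ico (B.isLoop Y).pos _)
    (fun i hi j hj hij he => by
      obtain ⟨-, x, c, z, X, η, h1, h2⟩ := h i hi
      obtain ⟨hj, x', c', z', X', η', h1', h2'⟩ := h j hj
      simp only [h1, h1', Vert.state, Vert.value] at he
      exact hs.not_dvd_of_exit hij hj h1 h2 h1' h2' ((Int.natCast_dvd_natCast.2
        (Nat.gcd_dvd_right _ _)).trans (Int.ModEq.dvd he.symm)))
  simpa using this

/-- In units of n², low vertices contribute 2, high vertices 2 through X and 1 through Y, entries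
7/2 through X alone and 2 through the pair, exits 7/2. -/
theorem sum_edgeCost_le :
    ∑ t ∈ Finset.range M, edgeCost (f t) (f (t + 1)) ≤ 14 * (Fintype.card Q : ℚ) ^ 2 := by
  set n := Fintype.card Q with hn
  let gX : A.ι → ℚ := fun X => 1 + (A.supp X).card / A.eff X
  let gY : B.ι → ℚ := fun Y => (B.supp Y).card / B.eff Y
  let eX : A.ι → ℚ := fun X => (A.supp X).card * (1 + 5 * n / 2 / A.eff X)
  let eXY : A.ι × B.ι → ℚ := fun p =>
    ((A.supp p.1).card * B.eff p.2 + (B.supp p.2).card * A.eff p.1) /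
      Nat.gcd (A.eff p.1) (B.eff p.2)
  let eY : B.ι → ℚ := fun Y => (B.supp Y).card * (1 + 5 * n / 2 / B.eff Y)
  have gX0 : ∀ X, 0 ≤ gX X := fun X => by positivity
  have gY0 : ∀ Y, 0 ≤ gY Y := fun Y => by positivity
  have eX0 : ∀ X, 0 ≤ eX X := fun X => by positivity
  have eXY0 : ∀ p, 0 ≤ eXY p := fun p => by positivity
  have eY0 : ∀ Y, 0 ≤ eY Y := fun Y => by positivity
  have o0 : ∀ _ : Unit, (0 : ℚ) ≤ 1 := fun _ => zero_le_one
  let P₁ : Unit → ℕ → Prop := fun _ t => ∃ z c, f t = .low z c ∧ c < 2 * n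
  let P₂ : A.ι → ℕ → Prop := fun X t => ∃ z Y η, f t = .high z X Y η
  let P₃ : B.ι → ℕ → Prop := fun Y t => ∃ z X η, f t = .high z X Y η
  let P₄ : A.ι → ℕ → Prop := fun X t =>
    ∃ x c z Y η, f t = .low x c ∧ f (t + 1) = .high z X Y η
  let P₅ : A.ι × B.ι → ℕ → Prop := fun p t =>
    ∃ x c z η, f t = .low x c ∧ f (t + 1) = .high z p.1 p.2 η
  let P₆ : B.ι → ℕ → Prop := fun Y t =>
    ∃ x c z X η, f t = .high z X Y η ∧ f (t + 1) = .low x c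
  have b₁ := sum_indicatorSum_le (P := P₁) (M := M) o0 fun _ => hs.card_low_le
  have b₂ := sum_indicatorSum_le (P := P₂) (M := M) gX0 hs.card_high_left_le
  have b₃ := sum_indicatorSum_le (P := P₃) (M := M) gY0 hs.card_high_right_le
  have b₄ := sum_indicatorSum_le (P := P₄) (M := M) eX0 hs.card_entry_le
  have b₅ := sum_indicatorSum_le (P := P₅) (M := M) eXY0 fun p => hs.card_entry_pair_le p.1 p.2
  have b₆ := sum_indicatorSum_le (P := P₆) (M := M) eY0 hs.card_exit_le
  have hle : ∀ t ∈ Finset.range M, edgeCost (f t) (f (t + 1)) ≤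
      indicatorSum P₁ (fun _ => 1) t + indicatorSum P₂ gX t + indicatorSum P₃ gY t +
      indicatorSum P₄ eX t + indicatorSum P₅ eXY t + indicatorSum P₆ eY t := by
    intro t ht
    have i₁ := indicatorSum_nonneg (P := P₁) o0 t
    have i₂ := indicatorSum_nonneg (P := P₂) gX0 t
    have i₃ := indicatorSum_nonneg (P := P₃) gY0 t
    have i₄ := indicatorSum_nonneg (P := P₄) eX0 t
    have i₅ := indicatorSum_nonneg (P := P₅) eXY0 t
    have i₆ := indicatorSum_nonneg (P := P₆) eY0 t
    have hE := hs.edge t (Finset.mem_range.1 ht)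
    generalize hv : f t = v at hE
    generalize hv' : f (t + 1) = v' at hE
    cases hE with
    | low _ h1 _ =>
      have j₁ := le_indicatorSum (P := P₁) o0 (i := ()) ⟨_, _, hv, h1⟩
      rw [edgeCost]
      linarith
    | @entry _ _ _ X Y _ _ =>
      have j₄ := le_indicatorSum (P := P₄) eX0 ⟨_, _, _, _, _, hv, hv'⟩
      have j₅ := le_indicatorSum (P := P₅) eXY0 (i := (X, Y)) ⟨_, _, _, _, hv, hv'⟩
      rw [edgeCost, entryCost]
      simp only [eX, eXY] at j₄ j₅
      linarith
    | walk _ =>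
      have j₂ := le_indicatorSum (P := P₂) gX0 ⟨_, _, _, hv⟩
      have j₃ := le_indicatorSum (P := P₃) gY0 ⟨_, _, _, hv⟩
      rw [edgeCost, walkCost]
      simp only [gX, gY] at j₂ j₃
      linarith
    | exit _ =>
      have j₂ := le_indicatorSum (P := P₂) gX0 ⟨_, _, _, hv⟩
      have j₃ := le_indicatorSum (P := P₃) gY0 ⟨_, _, _, hv⟩
      have j₆ := le_indicatorSum (P := P₆) eY0 ⟨_, _, _, _, _, hv, hv'⟩
      rw [edgeCost, walkCost, exitCost]
      simp only [gX, gY, eY] at j₂ j₃ j₆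
      linarith
  refine (Finset.sum_le_sum hle).trans ?_
  simp only [Finset.sum_add_distrib]
  have hn0 : (0 : ℚ) ≤ n := by positivity
  have sA : ∑ X, ((A.supp X).card : ℚ) ≤ n := by exact_mod_cast A.sum_card_le
  have sB : ∑ Y, ((B.supp Y).card : ℚ) ≤ n := by exact_mod_cast B.sum_card_le
  have a0 : ∀ X, (0 : ℚ) < A.eff X := fun X => by exact_mod_cast (A.isLoop X).pos
  have b0 : ∀ Y, (0 : ℚ) < B.eff Y := fun Y => by exact_mod_cast (B.isLoop Y).pos
  have aX : ∀ X, (A.eff X : ℚ) ≤ (A.supp X).card := fun X => by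
    exact_mod_cast (A.isLoop X).le_card
  have bY : ∀ Y, (B.eff Y : ℚ) ≤ (B.supp Y).card := fun Y => by
    exact_mod_cast (B.isLoop Y).le_card
  have aN : ∀ X, ((A.supp X).card : ℚ) ≤ n := fun X => by
    exact_mod_cast Finset.card_le_univ (A.supp X)
  have bN : ∀ Y, ((B.supp Y).card : ℚ) ≤ n := fun Y => by
    exact_mod_cast Finset.card_le_univ (B.supp Y)
  have c₁ : ∑ _i : Unit, ((2 * n ^ 2 : ℕ) : ℚ) * 1 = 2 * n ^ 2 := by simp
  have c₂ : ∑ X, ((n * A.eff X : ℕ) : ℚ) * gX X ≤ 2 * n * n := by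
    refine le_trans (Finset.sum_le_sum (g := fun X => 2 * n * ((A.supp X).card : ℚ))
      fun X _ => ?_) ?_
    · have : ((n * A.eff X : ℕ) : ℚ) * gX X = n * (A.eff X + (A.supp X).card) := by
        have := (a0 X).ne'
        simp only [gX]
        push_cast
        field_simp
      rw [this]
      nlinarith [aX X]
    · rw [← Finset.mul_sum]
      exact mul_le_mul_of_nonneg_left sA (by positivity)
  have c₃ : ∑ Y, ((n * B.eff Y : ℕ) : ℚ) * gY Y ≤ n * n := by
    refine le_trans (Finset.sum_le_sum (g := fun Y => n * ((B.supp Y).card : ℚ))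
      fun Y _ => ?_) ?_
    · have := (b0 Y).ne'
      simp only [gY]
      push_cast
      refine le_of_eq ?_
      field_simp
    · rw [← Finset.mul_sum]
      exact mul_le_mul_of_nonneg_left sB hn0
  have c₄ : ∑ X, (A.eff X : ℚ) * eX X ≤ 7 / 2 * n * n := by
    refine le_trans (Finset.sum_le_sum (g := fun X => 7 / 2 * n * ((A.supp X).card : ℚ))
      fun X _ => ?_) ?_
    · have : (A.eff X : ℚ) * eX X = (A.supp X).card * (A.eff X + 5 * n / 2) := by
        have := (a0 X).ne'
        simp only [eX]
        field_simp
      rw [this]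
      nlinarith [aX X, aN X, a0 X]
    · rw [← Finset.mul_sum]
      exact mul_le_mul_of_nonneg_left sA (by positivity)
  have c₆ : ∑ Y, (B.eff Y : ℚ) * eY Y ≤ 7 / 2 * n * n := by
    refine le_trans (Finset.sum_le_sum (g := fun Y => 7 / 2 * n * ((B.supp Y).card : ℚ))
      fun Y _ => ?_) ?_
    · have : (B.eff Y : ℚ) * eY Y = (B.supp Y).card * (B.eff Y + 5 * n / 2) := by
        have := (b0 Y).ne'
        simp only [eY]
        field_simp
      rw [this]
      nlinarith [bY Y, bN Y, b0 Y]
    · rw [← Finset.mul_sum]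
      exact mul_le_mul_of_nonneg_left sB (by positivity)
  -- The number of entries for a pair cancels the gcd, leaving |X| `eff Y` + |Y| `eff X`, at most
  -- 2|X||Y|; the double sum then factors.
  have c₅ : ∑ p : A.ι × B.ι, (Nat.gcd (A.eff p.1) (B.eff p.2) : ℚ) * eXY p ≤ 2 * (n * n) := by
    refine le_trans (Finset.sum_le_sum
      (g := fun p => 2 * (((A.supp p.1).card : ℚ) * (B.supp p.2).card)) fun p _ => ?_) ?_
    · have g0 : (0 : ℚ) < Nat.gcd (A.eff p.1) (B.eff p.2) := by
        exact_mod_cast Nat.gcd_pos_of_pos_left _ (A.isLoop p.1).pos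
      simp only [eXY]
      rw [mul_div_cancel₀ _ g0.ne']
      nlinarith [aX p.1, bY p.2, a0 p.1, b0 p.2]
    · rw [← Finset.mul_sum, Fintype.sum_prod_type]
      dsimp only
      rw [← Finset.sum_mul_sum]
      have := mul_le_mul sA sB (Finset.sum_nonneg fun _ _ => Nat.cast_nonneg _) hn0
      linarith
  have := add_le_add (add_le_add (add_le_add (add_le_add (add_le_add
    (b₁.trans c₁.le) (b₂.trans c₂)) (b₃.trans c₃)) (b₄.trans c₄)) (b₅.trans c₅)) (b₆.trans c₆)
  refine this.trans (le_of_eq ?_)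
  ring

end IsShortest

theorem exists_stepsIn_le_of_stepsIn {k : ℕ} {p q : Q} {c : ℕ}
    (h : StepsIn S.Step k (p, 0) (q, c)) :
    ∃ l ≤ 14 * Fintype.card Q ^ 2, ∃ c', StepsIn S.Step l (p, 0) (q, c') := by
  obtain ⟨A⟩ := nonempty_loopFamily S.nonzeroTransitions
  obtain ⟨B⟩ := nonempty_loopFamily (negEffects S.nonzeroTransitions)
  obtain ⟨f, h0, hk, hf⟩ := h.exists_fun
  obtain ⟨c', hr⟩ := exists_reflTransGen_low (A := A) (B := B) hf (by rw [h0])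
  rw [h0, hk] at hr
  obtain ⟨m, hm⟩ := StepsIn.of_reflTransGen hr
  obtain ⟨M, g, -, g0, gM, hg, hmin⟩ := hm.exists_shortest
  have hs : IsShortest g M := ⟨⟨_, _, g0⟩, ⟨_, _, gM⟩, hg, hmin⟩
  obtain ⟨l, hl, hl'⟩ := hs.exists_stepsIn g0 M le_rfl _ _ gM
  refine ⟨l, ?_, c', hl⟩
  have := hl'.trans hs.sum_edgeCost_le
  exact_mod_cast this

end OneCounterSystem


/-! ### Words of automata, and the family proving optimality. -/

namespace OneCounterAutomaton

theorem exists_word_length_le {A : Type u} {Q : Type v} [Fintype Q]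
    (M : OneCounterAutomaton A Q) (h : ∃ w : List A, w ∈ M.language) :
    ∃ w ∈ M.language, w.length ≤ 14 * Fintype.card Q ^ 2 := by
  obtain ⟨_, p, hp, q, hq, c, σ, hσ, -⟩ := h
  obtain ⟨l, hl, c', h'⟩ := OneCounterSystem.exists_stepsIn_le_of_stepsIn hσ.stepsIn
  obtain ⟨τ, hτ, rfl⟩ := OneCounterSystem.exists_isPath h'
  exact ⟨M.word τ, ⟨p, hp, q, hq, c', τ, hτ, rfl⟩, (List.length_filterMap_le _ _).trans hl⟩

/-- An automaton which first adds a multiple of `k` to the counter, along a cycle of `k` states,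
then subtracts a multiple of `k + 1`, along a cycle of `k + 1` states, and tests for zero. -/
def twoCycles {A : Type u} (a : A) (n k : ℕ) : OneCounterAutomaton A (Fin n) where
  nonzeroTransitions := {t |
    (t.1.val < k ∧ t.2.1 = 1 ∧ t.2.2.val = (t.1.val + 1) % k) ∨
    (t.1.val = 0 ∧ t.2.1 = 0 ∧ t.2.2.val = k) ∨
    ∃ j ≤ k, t.1.val = k + j ∧ t.2.1 = -1 ∧ t.2.2.val = k + (j + 1) % (k + 1)}
  zeroTests := {t |
    (t.1.val = 0 ∧ t.2.1 = 1 ∧ t.2.2.val = 1 % k) ∨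
    (t.1.val = k ∧ t.2.1 = 0 ∧ t.2.2.val = 2 * k + 1)}
  nonzero_effect := by
    rintro t (⟨-, h, -⟩ | ⟨-, h, -⟩ | ⟨j, -, -, h, -⟩) <;> simp [h]
  zero_effect := by
    rintro t (⟨-, h, -⟩ | ⟨-, h, -⟩) <;> simp [h]
  label _ := some a
  initial := {q | q.val = 0}
  final := {q | q.val = 2 * k + 1}

variable {A : Type u} {a : A} {n k : ℕ}

theorem twoCycles_word_length (σ : List (Fin n × ℤ × Fin n)) :
    ((twoCycles a n k).word σ).length = σ.length := by
  have : (twoCycles a n k).word σ = σ.map fun _ => a :=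
    congrFun (List.filterMap_eq_map (f := fun _ => a)) σ
  rw [this, List.length_map]

/-- An invariant of the configurations of `twoCycles` reached by `L` transitions. -/
def TwoCyclesInv (k L q c : ℕ) : Prop :=
  (q < k ∧ c % k = q ∧ c ≤ L) ∨
  (∃ j ≤ k, q = k + j ∧ ∃ e, 0 < e + c ∧ k ∣ e + c ∧ e + c ≤ L ∧ e % (k + 1) = j) ∨
  (q = 2 * k + 1 ∧ k * (k + 1) ≤ L)

/-- In the second disjunct `e` is the amount already subtracted, so `e + c` is the value at which
the first cycle was left. It is positive because that cycle can only be left by a non-zero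
transition. -/
theorem TwoCyclesInv.step (hk : 1 ≤ k) {L : ℕ} {γ γ' : Fin n × ℕ}
    (h : TwoCyclesInv k L γ.1 γ.2) (hs : (twoCycles a n k).Step γ γ') :
    TwoCyclesInv k (L + 1) γ'.1 γ'.2 := by
  obtain ⟨q, c⟩ := γ
  obtain ⟨q', c'⟩ := γ'
  obtain ⟨⟨p, d, r⟩, ht, h1, h2, he⟩ := hs
  simp only at h h1 h2 he ⊢
  subst h1 h2
  simp only [twoCycles, Set.mem_ofPred_eq] at ht
  rcases h with ⟨hq, hc, hL⟩ | ⟨j, hj, hq, e, h0, hd, hL, he'⟩ | ⟨hq, hL⟩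
  · rcases ht with ⟨hc1, ⟨-, rfl, hr⟩ | ⟨hq0, rfl, hr⟩ | ⟨j, hj, hqj, -⟩⟩ |
      ⟨hc0, ⟨hq0, rfl, hr⟩ | ⟨hqk, -⟩⟩
    · left
      obtain rfl : c' = c + 1 := by omega
      refine ⟨hr ▸ Nat.mod_lt _ hk, ?_, by omega⟩
      rw [hr, ← hc, Nat.mod_add_mod]
    · right; left
      obtain rfl : c' = c := by omega
      exact ⟨0, Nat.zero_le _, hr, 0, by omega, by
        rw [zero_add]; exact Nat.dvd_of_mod_eq_zero (hc.trans hq0), by omega, Nat.zero_mod _⟩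
    · omega
    · left
      obtain rfl : c' = 1 := by omega
      exact ⟨hr ▸ Nat.mod_lt _ hk, hr.symm, by omega⟩
    · omega
  · rcases ht with ⟨hc1, ⟨hqk, -⟩ | ⟨hq0, -⟩ | ⟨i, hi, hqi, rfl, hr⟩⟩ |
      ⟨hc0, ⟨hq0, -⟩ | ⟨hqk, rfl, hr⟩⟩
    · omega
    · omega
    · right; left
      obtain rfl : i = j := by omega
      have hc' : e + 1 + c' = e + c := by omega
      exact ⟨_, Nat.lt_succ_iff.1 (Nat.mod_lt _ (Nat.succ_pos k)), hr, e + 1, by omega,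
        hc' ▸ hd, by omega, by rw [← he', Nat.mod_add_mod]⟩
    · omega
    · right; right
      have hj0 : j = 0 := by omega
      subst hc0
      refine ⟨hr, ?_⟩
      -- At the zero test `c = 0`, so `e` is divisible by the coprime numbers `k` and `k + 1`.
      have h3 : k * (k + 1) ∣ e := Nat.Coprime.mul_dvd_of_dvd_of_dvd (by simp)
        (by simpa using hd) (Nat.dvd_of_mod_eq_zero (he'.trans hj0))
      have := Nat.le_of_dvd (by omega) h3
      omega
  · rcases ht with ⟨hc1, ⟨hqk, -⟩ | ⟨hq0, -⟩ | ⟨i, hi, hqi, -⟩⟩ | ⟨hc0, ⟨hq0, -⟩ | ⟨hqk, -⟩⟩ <;>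
      omega

theorem le_length_of_mem_twoCycles (hk : 1 ≤ k) {w : List A}
    (hw : w ∈ (twoCycles a n k).language) : k * (k + 1) ≤ w.length := by
  obtain ⟨p, hp, q, hq, c, σ, hσ, rfl⟩ := hw
  rw [twoCycles_word_length]
  obtain ⟨f, h0, hL, hf⟩ := hσ.stepsIn.exists_fun
  have hp : p.val = 0 := hp
  have hq : q.val = 2 * k + 1 := hq
  have inv : ∀ i ≤ σ.length, TwoCyclesInv k i (f i).1 (f i).2 := by
    intro i
    induction i with
    | zero => intro _; left; rw [h0]; exact ⟨show p.val < k by omega, by simp [hp], le_rfl⟩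
    | succ i ih => intro hi; exact (ih (by omega)).step hk (hf i (by omega))
  have := inv _ le_rfl
  rw [hL] at this
  rcases this with ⟨h, -⟩ | ⟨j, hj, h, -⟩ | ⟨-, h⟩
  · simp only at h; omega
  · simp only at h; omega
  · exact h

theorem twoCycles_up (hk : 1 ≤ k) (hn : 2 * k + 2 ≤ n) (c : ℕ) :
    StepsIn (twoCycles a n k).Step c (⟨0, by omega⟩, 0)
      (⟨c % k, (Nat.mod_lt _ hk).trans_le (by omega)⟩, c) := by
  induction c with
  | zero => simpa using StepsIn.refl _
  | succ c ih =>
    refine ih.trans (.single ⟨(⟨c % k, _⟩, 1, ⟨(c + 1) % k, _⟩), ?_, rfl, rfl, by simp⟩)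
    rcases Nat.eq_zero_or_pos c with rfl | hc
    · exact Or.inr ⟨rfl, Or.inl ⟨by simp, rfl, by simp⟩⟩
    · exact Or.inl ⟨hc, Or.inl ⟨Nat.mod_lt _ hk, rfl, by simp⟩⟩

theorem twoCycles_down (hn : 2 * k + 2 ≤ n) (c d : ℕ) :
    StepsIn (twoCycles a n k).Step d (⟨k, by omega⟩, c + d)
      (⟨k + d % (k + 1), by have := Nat.mod_lt d (show 0 < k + 1 by omega); omega⟩, c) := by
  induction d generalizing c with
  | zero => simpa using StepsIn.refl _
  | succ d ih =>
    have := ih (c + 1)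
    rw [show c + 1 + d = c + (d + 1) by omega] at this
    refine this.trans (.single ⟨(⟨k + d % (k + 1), _⟩, -1, ⟨k + (d + 1) % (k + 1), _⟩),
      ?_, rfl, rfl, by simp⟩)
    exact Or.inl ⟨Nat.succ_pos c, Or.inr (Or.inr ⟨d % (k + 1),
      Nat.lt_succ_iff.1 (Nat.mod_lt _ (Nat.succ_pos k)), rfl, rfl, by simp⟩)⟩

theorem twoCycles_language_nonempty (hk : 1 ≤ k) (hn : 2 * k + 2 ≤ n) :
    ∃ w, w ∈ (twoCycles a n k).language := by
  have s₁ := twoCycles_up (a := a) hk hn (k * (k + 1))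
  have s₂ : (twoCycles a n k).Step (⟨0, by omega⟩, k * (k + 1)) (⟨k, by omega⟩, k * (k + 1)) :=
    ⟨(⟨0, by omega⟩, 0, ⟨k, by omega⟩),
      Or.inl ⟨Nat.mul_pos hk (Nat.succ_pos k), Or.inr (Or.inl ⟨rfl, rfl, rfl⟩)⟩, rfl, rfl, by simp⟩
  have s₃ := twoCycles_down (a := a) hn 0 (k * (k + 1))
  have s₄ : (twoCycles a n k).Step (⟨k, by omega⟩, 0) (⟨2 * k + 1, by omega⟩, 0) :=
    ⟨(⟨k, by omega⟩, 0, ⟨2 * k + 1, by omega⟩), Or.inr ⟨rfl, Or.inr ⟨rfl, rfl, rfl⟩⟩, rfl, rfl,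
      by simp⟩
  simp only [Nat.mul_mod_right, Nat.mul_mod_left, Nat.add_zero, Nat.zero_add] at s₁ s₃
  obtain ⟨σ, hσ, -⟩ :=
    OneCounterSystem.exists_isPath (((s₁.trans (.single s₂)).trans s₃).trans (.single s₄))
  exact ⟨_, _, rfl, _, rfl, 0, σ, hσ, rfl⟩

end OneCounterAutomaton

theorem mainTheorem3 :
    -- every automaton with non-empty language accepts a word of length at most `14 n ^ 2`
    (∀ (A : Type u) [Finite A] (Q : Type v) [Fintype Q] (M : OneCounterAutomaton A Q),
      (∃ w : List A, w ∈ M.language) →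
        ∃ w ∈ M.language, w.length ≤ 14 * Fintype.card Q ^ 2) ∧
    -- the order of magnitude cannot be improved
    (∃ c : ℝ, 0 < c ∧ ∃ N : ℕ, ∀ n : ℕ, N ≤ n → ∀ (A : Type u) [Finite A] [Nonempty A],
      ∃ M : OneCounterAutomaton A (Fin n),
        (∃ w : List A, w ∈ M.language) ∧
          ∀ w ∈ M.language, c * (n : ℝ) ^ 2 ≤ (w.length : ℝ)) := by
  refine ⟨fun A _ Q _ M h => M.exists_word_length_le h, 1 / 16, by norm_num, 4,
    fun n hn A _ _ => ?_⟩
  -- The automaton needs 2k + 2 states, so `n ≥ 4` allows `k ≥ 1`; the constant 1/16 works since (2k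
  -- + 3)² ≤ 16k(k + 1) for such `k`.
  obtain ⟨k, hk, hk1, hk2⟩ : ∃ k, 1 ≤ k ∧ 2 * k + 2 ≤ n ∧ n ≤ 2 * k + 3 :=
    ⟨(n - 2) / 2, by omega, by omega, by omega⟩
  refine ⟨.twoCycles (Classical.arbitrary A) n k,
    OneCounterAutomaton.twoCycles_language_nonempty hk hk1, fun w hw => ?_⟩
  have h1 : ((k * (k + 1) : ℕ) : ℝ) ≤ w.length := by
    exact_mod_cast OneCounterAutomaton.le_length_of_mem_twoCycles hk hw
  have h2 : (n : ℝ) ≤ 2 * k + 3 := by exact_mod_cast hk2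
  have h3 : (1 : ℝ) ≤ k := by exact_mod_cast hk
  have h4 : (n : ℝ) ^ 2 ≤ (2 * k + 3) ^ 2 := by gcongr
  push_cast at h1
  nlinarith
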